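/- **Theorem 1.1.** Let $m=(m_1,\dots,m_n)$ be positive integers and let $D\subset\mathbb C^n$ be a bounded quasi-circular domain of weight $m$ containing the origin, i.e. a bounded connected open set with $0\in D$ that is invariant under $(z_1,\dots,z_n)\mapsto(e^{im_1\theta}z_1,\dots,e^{im_n\theta}z_n)$ for every $\theta\in\mathbb R$. For a multi-index $\alpha\in\mathbb Z_{\ge 0}^n$ write $|\alpha|=\sum_j\alpha_j$ and $m\cdot\alpha=\sum_j m_j\alpha_j$, and let $\langle\phi,\psi\rangle_D=\int_D\phi\,\overline{\psi}\,dV$. (a) For every $\alpha$ there is a unique polynomial $p_\alpha$ such that $\langle h,p_\alpha\rangle_D=\frac{\partial^{\alpha}h}{\partial z^\alpha}(0)$ for all holomorphic functions $h\in L^2(D)$. It is $m$-homogeneous of order $m\cdot\alpha$: $p_\alpha=\sum_{m\cdot\beta=m\cdot\alpha}b^\alpha_\beta z^\beta$. Let $d(\alpha)=\min\{|\beta| : b^\alpha_\beta\neq 0\}$, let $Q_k=\{\alpha : d(\alpha)\le k\}$ for $k\in\mathbb Z_{\ge 0}$, and for $1\le i\le n$ let $\mu_i=\max\{|\alpha|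 : m\cdot\alpha=m_i\}$ (the $i$-th resonance order) and $\nu_i=\max\{|\alpha| : \alpha\in Q_{\mu_i}\}$ (the $i$-th quasi-resonance order). Let $\nu=\max_{1\le i\le n}\nu_i$ (the quasi-resonance order; $\nu=0$ if $n=0$). (b) The maxima defining $\nu_1,\dots,\nu_n$ exist. (c) Let $f$ be an automorphism of $D$ (a biholomorphic map of $D$ onto itself) with $f(0)=0$. Then $f=(f_1,\dots,f_n)$ is a polynomial mapping, $\deg f_i\le\nu_i$ for each $1\le i\le n$, and hence $\deg f=\max_i\deg f_i\le\nu$. -/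

import Mathlib

namespace QuasiCircular

/-- `D` is a bounded quasi-circular domain in `ℂⁿ` containing the origin, with weight `m`:
a bounded connected open set containing `0`, invariant under all the maps
`(z₁, …, zₙ) ↦ (e^{i m₁ θ} z₁, …, e^{i mₙ θ} zₙ)`, where the `m i` are positive integers. -/
structure IsBoundedQuasiCircularDomain {n : ℕ} (m : Fin n → ℕ) (D : Set (Fin n → ℂ)) :
    Prop where
  isOpen : IsOpen D
  isConnected : IsConnected D
  isBounded : Bornology.IsBounded D
  zero_mem : (0 : Fin n → ℂ) ∈ D
  weight_pos : ∀ i, 0 < m i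
  invariant : ∀ θ : ℝ, ∀ z ∈ D,
    (fun i => Complex.exp (Complex.I * (m i : ℂ) * (θ : ℂ)) * z i) ∈ D

/-- `f` restricts to an automorphism of the domain `D`: a biholomorphic map of `D` onto `D`.
Only the values of `f` on `D` matter. -/
def IsAutomorphism {n : ℕ} (D : Set (Fin n → ℂ)) (f : (Fin n → ℂ) → (Fin n → ℂ)) : Prop :=
  DifferentiableOn ℂ f D ∧ Set.MapsTo f D D ∧
    ∃ F : (Fin n → ℂ) → (Fin n → ℂ), DifferentiableOn ℂ F D ∧ Set.MapsTo F D D ∧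
      (∀ z ∈ D, F (f z) = z) ∧ (∀ z ∈ D, f (F z) = z)

/-- The complex partial derivative `∂g/∂zᵢ`. -/
noncomputable def partialDeriv {n : ℕ} (i : Fin n) (g : (Fin n → ℂ) → ℂ) :
    (Fin n → ℂ) → ℂ :=
  fun z => fderiv ℂ g z (Pi.single i 1)

/-- The iterated complex partial derivative
`∂^α h / ∂z^α = (∂/∂z₁)^{α₁} ⋯ (∂/∂zₙ)^{αₙ} h`. -/
noncomputable def multiDeriv {n : ℕ} (α : Fin n →₀ ℕ) (h : (Fin n → ℂ) → ℂ) :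
    (Fin n → ℂ) → ℂ :=
  (List.finRange n).foldr (fun i g => (partialDeriv i)^[α i] g) h

/-- The `L²(D)` inner product `⟨φ, ψ⟩_D = ∫_D φ ψ̄ dV`, with `dV` Lebesgue measure on `ℂⁿ`. -/
noncomputable def innerL2 {n : ℕ} (D : Set (Fin n → ℂ)) (φ ψ : (Fin n → ℂ) → ℂ) : ℂ :=
  ∫ z in D, φ z * (starRingEnd ℂ) (ψ z)

/-- The polynomial `p` reproduces the derivative of order `α` at the origin:
`⟨h, p⟩_D = (∂^α h / ∂z^α)(0)` for all holomorphic functions `h` in `L²(D)`. -/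
def IsReproducing {n : ℕ} (D : Set (Fin n → ℂ)) (α : Fin n →₀ ℕ)
    (p : MvPolynomial (Fin n) ℂ) : Prop :=
  ∀ h : (Fin n → ℂ) → ℂ, DifferentiableOn ℂ h D →
    MeasureTheory.MemLp h 2 (MeasureTheory.volume.restrict D) →
    innerL2 D h (fun z => MvPolynomial.eval z p) = multiDeriv α h 0

open Classical in
/-- The reproducing polynomial `p_α` of `D` (with value `0` if there were none). -/
noncomputable def reproPoly {n : ℕ} (D : Set (Fin n → ℂ)) (α : Fin n →₀ ℕ) :
    MvPolynomial (Fin n) ℂ :=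
  if h : ∃ p, IsReproducing D α p then h.choose else 0

/-- The `i`-th resonance set `E_i = {α : m · α = m_i}`. -/
def resonanceSet {n : ℕ} (m : Fin n → ℕ) (i : Fin n) : Set (Fin n →₀ ℕ) :=
  {α | Finsupp.weight m α = m i}

/-- The `i`-th resonance order `μ_i = max {|α| : α ∈ E_i}`. -/
noncomputable def resonanceOrder {n : ℕ} (m : Fin n → ℕ) (i : Fin n) : ℕ :=
  sSup (Finsupp.degree '' resonanceSet m i)

/-- For positive weights, the maximum defining `μ_i` is attained. -/
theorem isGreatest_resonanceOrder {n : ℕ} (m : Fin n → ℕ) (hm : ∀ i, 0 < m i) (i : Fin n) :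
    IsGreatest (Finsupp.degree '' resonanceSet m i) (resonanceOrder m i) := by
  have hfin : (resonanceSet m i).Finite :=
    Finsupp.finite_of_nat_weight_eq m (fun x => (hm x).ne') (m i)
  have hne : (Finsupp.degree '' resonanceSet m i).Nonempty :=
    ⟨_, Finsupp.single i 1, by simp [resonanceSet, Finsupp.weight_single], rfl⟩
  have hbdd := (hfin.image Finsupp.degree).bddAbove
  exact ⟨Nat.sSup_mem hne hbdd, fun _ hx => le_csSup hbdd hx⟩

/-- `d(α)`: the minimum of `|β|` over the monomials `z^β` that occur (with nonzero coefficient)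
in `p_α`. -/
noncomputable def minDegree {n : ℕ} (D : Set (Fin n → ℂ)) (α : Fin n →₀ ℕ) : ℕ :=
  sInf (Finsupp.degree '' {β | (reproPoly D α).coeff β ≠ 0})

/-- `Q_k`, the complement of `P_k = {α : d(α) > k}` in the set of all multi-indices. -/
def quasiSet {n : ℕ} (D : Set (Fin n → ℂ)) (k : ℕ) : Set (Fin n →₀ ℕ) :=
  {α | minDegree D α > k}ᶜ

/-- The `i`-th quasi-resonance order `ν_i = max {|α| : α ∈ Q_{μ_i}}`. -/
noncomputable def quasiResonanceOrderAt {n : ℕ} (m : Fin n → ℕ) (D : Set (Fin n → ℂ))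
    (i : Fin n) : ℕ :=
  sSup (Finsupp.degree '' quasiSet D (resonanceOrder m i))

/-- The quasi-resonance order `ν = max_i ν_i`. -/
noncomputable def quasiResonanceOrder {n : ℕ} (m : Fin n → ℕ) (D : Set (Fin n → ℂ)) : ℕ :=
  Finset.univ.sup (quasiResonanceOrderAt m D)

end QuasiCircular

/-! An automorphism $f$ with inverse $F$ acts on the Bergman space by $U_f\varphi=(\varphi\circ
f)\,J_f$, with $J_f$ the complex Jacobian determinant. Since $|J_f|^2$ is the real Jacobian, the
adjoint of $U_f$ is $U_F$ (`innerL2_pullback`). Hence, for a polynomial $q$, $\partial^\alpha(U_f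
q)(0)=\langle U_f q,p_\alpha\rangle=\langle q,U_F p_\alpha\rangle$.

Let $q$ be $m$-homogeneous of weight $k$, let every $\beta$ of weight $k$ have $|\beta|\le N$, and
let $\alpha\notin Q_N$. Then $p_\alpha$ vanishes to order $N+1$ at $0$, and so does $U_F p_\alpha$
because $F(0)=0$. Its component of weight $k$ only involves derivatives of order at most $N$, so it
is zero, and $q$ is orthogonal to all other weights. Thus the Taylor coefficients of $U_f q$ live on
the finite set $Q_N$, and $U_f q$ is a polynomial (`multiDeriv_pullback_eval_eq_zero`,
`exists_pullback_eqOn_eval`). For $q=1$ and $k=N=0$ one has $Q_0=\{0\}$, so $J_f$ is a nonzero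
constant; for $q=z_i$ and $N=\mu_i$, $f_iJ_f$ is then a polynomial with exponents in $Q_{\mu_i}$.

The component of weight $k$ is the average of $h(\rho_\theta z)e^{-ik\theta}$ over the rotations
$\rho_\theta$, which preserve $D$ and its measure. Positive weights leave finitely many exponents of
each weight, so by the identity theorem this average is a polynomial on $D$; convergence of the
Taylor series on all of $D$ is never needed. The polynomial $p_\alpha$ then comes from duality on a
finite-dimensional weight space. -/

open MeasureTheory Metric Set Filter Topology

namespace QuasiCircular

/-! ### Cauchy estimates and differentiation under the integral sign -/

/-- Cauchy estimate: the derivative of a holomorphic function is bounded near a compact set. -/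
theorem exists_norm_fderiv_le {n : ℕ} {D K : Set (Fin n → ℂ)} (hD : IsOpen D) (hK : IsCompact K)
    (hKD : K ⊆ D) {h : (Fin n → ℂ) → ℂ} (hh : DifferentiableOn ℂ h D) :
    ∃ δ > 0, ∃ C : ℝ, ∀ x ∈ thickening δ K, x ∈ D ∧ ‖fderiv ℂ h x‖ ≤ C := by
  obtain ⟨δ, hδ, hsub⟩ := hK.exists_cthickening_subset_open hD hKD
  obtain ⟨M, hM⟩ := (hK.cthickening (r := δ)).exists_bound_of_continuousOn
    (hh.continuousOn.mono hsub)
  have key : ∀ x ∈ thickening (δ / 2) K, ball x (δ / 2) ⊆ cthickening δ K := by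
    intro x hx
    obtain ⟨k, hk, hxk⟩ := mem_thickening_iff.1 hx
    intro y hy
    refine thickening_subset_cthickening _ _ (mem_thickening_iff.2 ⟨k, hk, ?_⟩)
    have := dist_triangle y x k
    rw [mem_ball] at hy
    linarith
  -- On a ball of radius `δ / 2` the function deviates from its value at the centre by at most `2 *
  -- M`.
  refine ⟨δ / 2, by positivity, (2 * M) / (δ / 2), fun x hx => ?_⟩
  have hb := key x hx
  have hxb : x ∈ ball x (δ / 2) := mem_ball_self (by positivity)
  refine ⟨hsub (hb hxb), Complex.norm_fderiv_le_div_of_mapsTo_ball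
    (hh.mono (hb.trans hsub)) (fun y hy => ?_) (by positivity)⟩
  rw [mem_closedBall, dist_eq_norm]
  have h1 := hM y (hb hy)
  have h2 := hM x (hb hxb)
  exact (norm_sub_le _ _).trans (by linarith)

/-- The path $\theta\mapsto L_\theta z+c_\theta$ is compact in $D$, so the derivative of `h` is
bounded near it and a constant dominates the integrand's derivative. Serves both Cauchy's formula
(`L` the identity, `c` a circle) and circle averages (`L` a rotation, `c = 0`). -/
theorem hasFDerivAt_integral_comp_affine {n : ℕ} {D : Set (Fin n → ℂ)} (hD : IsOpen D)
    {h : (Fin n → ℂ) → ℂ} (hh : DifferentiableOn ℂ h D) {a b : ℝ} (w : ℝ → ℂ) (hw : Continuous w)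
    (L : ℝ → (Fin n → ℂ) →L[ℂ] (Fin n → ℂ)) (hL : Continuous L)
    (c : ℝ → (Fin n → ℂ)) (hc : Continuous c) (z : Fin n → ℂ)
    (hz : ∀ θ ∈ uIcc a b, L θ z + c θ ∈ D) :
    HasFDerivAt (fun x => ∫ θ in a..b, w θ * h (L θ x + c θ))
      (∫ θ in a..b, w θ • (fderiv ℂ h (L θ z + c θ)).comp (L θ)) z := by
  have hcont : Continuous fun θ => L θ z + c θ := by fun_prop
  obtain ⟨δ, hδ, C, hC⟩ := exists_norm_fderiv_le hD
    ((isCompact_uIcc (a := a) (b := b)).image hcont) (image_subset_iff.2 hz) hh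
  obtain ⟨A, hA⟩ := (isCompact_uIcc (a := a) (b := b)).exists_bound_of_continuousOn
    hL.continuousOn
  obtain ⟨W, hW⟩ := (isCompact_uIcc (a := a) (b := b)).exists_bound_of_continuousOn
    hw.continuousOn
  have hA0 : 0 ≤ A := (norm_nonneg _).trans (hA a left_mem_uIcc)
  have hW0 : 0 ≤ W := (norm_nonneg _).trans (hW a left_mem_uIcc)
  -- `A + 1` instead of `A`, since `A` may be zero.
  have hmem : ∀ θ ∈ uIcc a b, ∀ x ∈ ball z (δ / (A + 1)),
      L θ x + c θ ∈ thickening δ ((fun θ => L θ z + c θ) '' uIcc a b) := by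
    intro θ hθ x hx
    refine mem_thickening_iff.2 ⟨_, mem_image_of_mem _ hθ, ?_⟩
    rw [dist_add_right, dist_eq_norm, ← map_sub]
    rw [mem_ball, dist_eq_norm, lt_div_iff₀ (by positivity)] at hx
    calc ‖L θ (x - z)‖ ≤ ‖L θ‖ * ‖x - z‖ := (L θ).le_opNorm _
      _ ≤ A * ‖x - z‖ := by gcongr; exact hA θ hθ
      _ ≤ ‖x - z‖ * (A + 1) := by nlinarith [norm_nonneg (x - z)]
      _ < δ := hx
  have hball : ball z (δ / (A + 1)) ∈ 𝓝 z := ball_mem_nhds _ (by positivity)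
  have hcontF : ∀ x ∈ ball z (δ / (A + 1)),
      ContinuousOn (fun θ => w θ * h (L θ x + c θ)) (uIcc a b) := by
    intro x hx
    refine hw.continuousOn.mul (hh.continuousOn.comp (by fun_prop) fun θ hθ => ?_)
    exact (hC _ (hmem θ hθ x hx)).1
  refine intervalIntegral.hasFDerivAt_integral_of_dominated_of_fderiv_le
    (F := fun x θ => w θ * h (L θ x + c θ))
    (F' := fun x θ => w θ • (fderiv ℂ h (L θ x + c θ)).comp (L θ)) (bound := fun _ => W * (C * A))
    hball ?_ ?_ ?_ ?_ ?_ ?_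
  · filter_upwards [hball] with x hx
    exact ((hcontF x hx).mono uIoc_subset_uIcc).aestronglyMeasurable measurableSet_uIoc
  · exact (hcontF z (mem_ball_self (by positivity))).intervalIntegrable
  -- Measurability of `fderiv` suffices here; its continuity is deduced later from this very lemma.
  · have h1 : Measurable fun θ => fderiv ℂ h (L θ z + c θ) :=
      (measurable_fderiv ℂ h).comp hcont.measurable
    have h2 : StronglyMeasurable fun θ => (fderiv ℂ h (L θ z + c θ), L θ) :=
      (h1.stronglyMeasurable).prodMk hL.stronglyMeasurable
    have h3 : Continuous fun p : ((Fin n → ℂ) →L[ℂ] ℂ) × ((Fin n → ℂ) →L[ℂ] (Fin n → ℂ)) =>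
      p.1.comp p.2 := by fun_prop
    exact (hw.stronglyMeasurable.smul (h3.comp_stronglyMeasurable h2)).aestronglyMeasurable
  · refine Eventually.of_forall fun θ hθ x hx => ?_
    have hθ' := uIoc_subset_uIcc hθ
    rw [norm_smul]
    refine mul_le_mul (hW θ hθ') ?_ (norm_nonneg _) hW0
    have hb := (hC _ (hmem θ hθ' x hx)).2
    exact (ContinuousLinearMap.opNorm_comp_le _ _).trans
      (mul_le_mul hb (hA θ hθ') (norm_nonneg _) ((norm_nonneg _).trans hb))
  · exact intervalIntegrable_const
  · refine Eventually.of_forall fun θ hθ x hx => ?_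
    have hθ' := uIoc_subset_uIcc hθ
    have hd : HasFDerivAt h (fderiv ℂ h (L θ x + c θ)) (L θ x + c θ) :=
      (hh.differentiableAt (hD.mem_nhds (hC _ (hmem θ hθ' x hx)).1)).hasFDerivAt
    exact (hd.comp x ((L θ).hasFDerivAt.add_const (c θ))).const_mul (w θ)

/-! ### Holomorphy and symmetry of partial derivatives -/

section Partial
variable {n : ℕ} {D : Set (Fin n → ℂ)}

theorem partialDeriv_congr (hD : IsOpen D) {g h : (Fin n → ℂ) → ℂ} (hgh : EqOn g h D)
    (i : Fin n) : EqOn (partialDeriv i g) (partialDeriv i h) D := by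
  intro z hz
  have : g =ᶠ[𝓝 z] h := hgh.eventuallyEq_of_mem (hD.mem_nhds hz)
  simp only [partialDeriv, this.fderiv_eq]

theorem fderiv_apply_eq_sum (h : (Fin n → ℂ) → ℂ) (z v : Fin n → ℂ) :
    fderiv ℂ h z v = ∑ i, v i * partialDeriv i h z := by
  conv_lhs => rw [pi_eq_sum_univ' v]
  simp only [map_sum, map_smul, smul_eq_mul, partialDeriv]

/-- Partial derivatives of holomorphic functions are holomorphic, by differentiating Cauchy's
integral formula under the integral sign. -/
theorem differentiableOn_partialDeriv (hD : IsOpen D) {h : (Fin n → ℂ) → ℂ}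
    (hh : DifferentiableOn ℂ h D) (i : Fin n) : DifferentiableOn ℂ (partialDeriv i h) D := by
  intro z hz
  obtain ⟨r, hr, hrD⟩ := nhds_basis_closedBall.mem_iff.1 (hD.mem_nhds hz)
  set e : Fin n → ℂ := Pi.single i 1 with he
  have hnorm : ∀ t : ℂ, ‖t • e‖ = ‖t‖ := fun t => by
    rw [norm_smul, he, Pi.norm_single]; simp
  have hr2 : 0 < r / 2 := by positivity
  have hmem : ∀ x ∈ ball z (r / 2), ∀ t ∈ closedBall (0 : ℂ) (r / 2), x + t • e ∈ D := by
    intro x hx t ht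
    apply hrD
    rw [mem_closedBall, dist_eq_norm]
    rw [mem_ball, dist_eq_norm] at hx
    rw [mem_closedBall, dist_zero_right, ← hnorm] at ht
    calc ‖x + t • e - z‖ = ‖(x - z) + t • e‖ := by congr 1; abel
      _ ≤ r := (norm_add_le _ _).trans (by linarith)
  -- Cauchy's formula for the derivative at `0` of the slice $t\mapsto h(x+te_i)$, on a circle whose
  -- radius does not depend on `x`.
  have hform : ∀ x ∈ ball z (r / 2), partialDeriv i h x = (2 * Real.pi * Complex.I : ℂ)⁻¹ *
      ∫ θ in (0 : ℝ)..2 * Real.pi, deriv (circleMap 0 (r / 2)) θ *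
        ((circleMap 0 (r / 2) θ) ^ 2)⁻¹ * h (x + circleMap 0 (r / 2) θ • e) := by
    intro x hx
    set g : ℂ → ℂ := fun t => h (x + t • e)
    have hg : ∀ t ∈ closedBall (0 : ℂ) (r / 2), DifferentiableAt ℂ g t := by
      intro t ht
      have := hh.differentiableAt (hD.mem_nhds (hmem x hx t ht))
      exact this.comp t (by fun_prop)
    have hg' : DiffContOnCl ℂ g (ball 0 (r / 2)) := by
      refine DifferentiableOn.diffContOnCl fun t ht => ?_
      rw [closure_ball _ hr2.ne'] at ht
      exact (hg t ht).differentiableWithinAt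
    have hx0 : HasFDerivAt h (fderiv ℂ h x) (x + (0 : ℂ) • e) := by
      simpa using (hh.differentiableAt (hD.mem_nhds (by
        simpa using hmem x hx 0 (by simp [hr2.le])))).hasFDerivAt
    have hd : HasDerivAt g (fderiv ℂ h x e) 0 := by
      have h2 : HasDerivAt (fun t : ℂ => x + t • e) e 0 := by
        simpa using ((hasDerivAt_id (0 : ℂ)).smul_const e).const_add x
      exact hx0.comp_hasDerivAt (0 : ℂ) h2
    have hc := hg'.deriv_eq_smul_circleIntegral hr2
    rw [hd.deriv] at hc
    rw [eq_inv_mul_iff_mul_eq₀ Complex.two_pi_I_ne_zero]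
    refine Eq.trans hc.symm ?_
    simp [circleIntegral, g, mul_assoc]
  have hdiff := hasFDerivAt_integral_comp_affine hD hh (a := 0) (b := 2 * Real.pi)
    (fun θ => deriv (circleMap 0 (r / 2)) θ * ((circleMap 0 (r / 2) θ) ^ 2)⁻¹)
    (by
      simp only [deriv_circleMap]
      refine Continuous.mul (by fun_prop) (Continuous.inv₀ (by fun_prop) fun θ => ?_)
      exact pow_ne_zero _ (circleMap_ne_center hr2.ne'))
    (fun _ => ContinuousLinearMap.id ℂ _) continuous_const
    (fun θ => circleMap 0 (r / 2) θ • e) (by fun_prop) z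
    (fun θ _ => by
      simpa using hmem z (mem_ball_self hr2) _
        (sphere_subset_closedBall (circleMap_mem_sphere 0 hr2.le θ)))
  refine DifferentiableAt.differentiableWithinAt ?_
  refine (hdiff.differentiableAt.const_mul (2 * Real.pi * Complex.I : ℂ)⁻¹).congr_of_eventuallyEq ?_
  filter_upwards [ball_mem_nhds z hr2] with x hx
  simpa using hform x hx

theorem differentiableOn_fderiv (hD : IsOpen D) {h : (Fin n → ℂ) → ℂ}
    (hh : DifferentiableOn ℂ h D) : DifferentiableOn ℂ (fderiv ℂ h) D := by
  have : fderiv ℂ h = fun z => ∑ i, partialDeriv i h z •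
      (ContinuousLinearMap.proj i : (Fin n → ℂ) →L[ℂ] ℂ) := by
    ext z v
    simp [fderiv_apply_eq_sum, mul_comm]
  rw [this]
  exact DifferentiableOn.fun_sum fun i _ => (differentiableOn_partialDeriv hD hh i).smul_const _

theorem partialDeriv_comm (hD : IsOpen D) {h : (Fin n → ℂ) → ℂ}
    (hh : DifferentiableOn ℂ h D) (i j : Fin n) :
    EqOn (partialDeriv i (partialDeriv j h)) (partialDeriv j (partialDeriv i h)) D := by
  intro z hz
  have h1 : ∀ᶠ y in 𝓝 z, HasFDerivAt h (fderiv ℂ h y) y := by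
    filter_upwards [hD.mem_nhds hz] with y hy
    exact (hh.differentiableAt (hD.mem_nhds hy)).hasFDerivAt
  have h2 := ((differentiableOn_fderiv hD hh).differentiableAt (hD.mem_nhds hz)).hasFDerivAt
  have h3 : ∀ i j, partialDeriv i (partialDeriv j h) z =
      fderiv ℂ (fderiv ℂ h) z (Pi.single i 1) (Pi.single j 1) := by
    intro i j
    have := (h2.clm_apply (hasFDerivAt_const (Pi.single j 1 : Fin n → ℂ) z)).fderiv
    rw [partialDeriv]
    change fderiv ℂ (fun y => fderiv ℂ h y (Pi.single j 1)) z _ = _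
    rw [this]
    simp
  rw [h3, h3]
  exact second_derivative_symmetric_of_eventually h1 h2 _ _

end Partial

/-! ### Iterated derivatives and Taylor coefficients of polynomials -/

section MultiDeriv
variable {n : ℕ} {D : Set (Fin n → ℂ)}

theorem differentiableOn_iterate_partialDeriv (hD : IsOpen D) {h : (Fin n → ℂ) → ℂ}
    (hh : DifferentiableOn ℂ h D) (i : Fin n) (k : ℕ) :
    DifferentiableOn ℂ ((partialDeriv i)^[k] h) D := by
  induction k with
  | zero => exact hh
  | succ k ih =>
    rw [Function.iterate_succ_apply']
    exact differentiableOn_partialDeriv hD ih i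

theorem iterate_partialDeriv_congr (hD : IsOpen D) {g h : (Fin n → ℂ) → ℂ} (hgh : EqOn g h D)
    (i : Fin n) (k : ℕ) : EqOn ((partialDeriv i)^[k] g) ((partialDeriv i)^[k] h) D := by
  induction k with
  | zero => exact hgh
  | succ k ih =>
    simp only [Function.iterate_succ_apply']
    exact partialDeriv_congr hD ih i

theorem iterate_partialDeriv_comm (hD : IsOpen D) {h : (Fin n → ℂ) → ℂ}
    (hh : DifferentiableOn ℂ h D) (i j : Fin n) (k : ℕ) :
    EqOn ((partialDeriv i)^[k] (partialDeriv j h)) (partialDeriv j ((partialDeriv i)^[k] h)) D := by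
  induction k with
  | zero => exact fun _ _ => rfl
  | succ k ih =>
    simp only [Function.iterate_succ_apply']
    exact (partialDeriv_congr hD ih i).trans
      (partialDeriv_comm hD (differentiableOn_iterate_partialDeriv hD hh i k) i j)

theorem differentiableOn_foldr (hD : IsOpen D) {h : (Fin n → ℂ) → ℂ}
    (hh : DifferentiableOn ℂ h D) (α : Fin n →₀ ℕ) (l : List (Fin n)) :
    DifferentiableOn ℂ (l.foldr (fun i g => (partialDeriv i)^[α i] g) h) D := by
  induction l with
  | nil => exact hh
  | cons i l ih => exact differentiableOn_iterate_partialDeriv hD ih i _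

theorem differentiableOn_multiDeriv (hD : IsOpen D) {h : (Fin n → ℂ) → ℂ}
    (hh : DifferentiableOn ℂ h D) (α : Fin n →₀ ℕ) :
    DifferentiableOn ℂ (multiDeriv α h) D :=
  differentiableOn_foldr hD hh α _

theorem multiDeriv_congr (hD : IsOpen D) {g h : (Fin n → ℂ) → ℂ} (hgh : EqOn g h D)
    (α : Fin n →₀ ℕ) : EqOn (multiDeriv α g) (multiDeriv α h) D := by
  unfold multiDeriv
  induction List.finRange n with
  | nil => exact hgh
  | cons i l ih => exact iterate_partialDeriv_congr hD ih i _

theorem foldr_partialDeriv (hD : IsOpen D) {h : (Fin n → ℂ) → ℂ}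
    (hh : DifferentiableOn ℂ h D) (α : Fin n →₀ ℕ) (j : Fin n) (l : List (Fin n)) :
    EqOn (l.foldr (fun i g => (partialDeriv i)^[α i] g) (partialDeriv j h))
      (partialDeriv j (l.foldr (fun i g => (partialDeriv i)^[α i] g) h)) D := by
  induction l with
  | nil => exact fun _ _ => rfl
  | cons i l ih =>
    exact (iterate_partialDeriv_congr hD ih i _).trans
      (iterate_partialDeriv_comm hD (differentiableOn_foldr hD hh α l) i j _)

theorem foldr_add_single (hD : IsOpen D) {h : (Fin n → ℂ) → ℂ}
    (hh : DifferentiableOn ℂ h D) (α : Fin n →₀ ℕ) (j : Fin n) (l : List (Fin n))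
    (hl : l.Nodup) (hj : j ∈ l) :
    EqOn (l.foldr (fun i g => (partialDeriv i)^[(α + Finsupp.single j 1 : Fin n →₀ ℕ) i] g) h)
      (partialDeriv j (l.foldr (fun i g => (partialDeriv i)^[α i] g) h)) D := by
  induction l with
  | nil => simp at hj
  | cons i l ih =>
    rw [List.nodup_cons] at hl
    by_cases hij : i = j
    · subst hij
      have : l.foldr (fun k g => (partialDeriv k)^[(α + Finsupp.single i 1 : Fin n →₀ ℕ) k] g) h =
          l.foldr (fun k g => (partialDeriv k)^[α k] g) h := by
        refine List.foldr_ext _ _ _ fun k hk g => ?_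
        have hik : i ≠ k := fun hik => hl.1 (hik ▸ hk)
        simp [hik]
      rw [List.foldr_cons, this, Finsupp.add_apply, Finsupp.single_eq_same,
        Function.iterate_succ_apply']
      exact fun _ _ => rfl
    · have hjl : j ∈ l := (List.mem_cons.1 hj).resolve_left (Ne.symm hij)
      have h0 : (α + Finsupp.single j 1 : Fin n →₀ ℕ) i = α i := by simp [Ne.symm hij]
      simp only [List.foldr_cons, h0]
      exact (iterate_partialDeriv_congr hD (ih hl.2 hjl) i _).trans
        (iterate_partialDeriv_comm hD (differentiableOn_foldr hD hh α l) i j _)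

theorem multiDeriv_add_single (hD : IsOpen D) {h : (Fin n → ℂ) → ℂ}
    (hh : DifferentiableOn ℂ h D) (α : Fin n →₀ ℕ) (j : Fin n) :
    EqOn (multiDeriv (α + Finsupp.single j 1) h) (partialDeriv j (multiDeriv α h)) D :=
  foldr_add_single hD hh α j _ (List.nodup_finRange n) (List.mem_finRange j)

/-- Moves the extra derivative innermost, so that an induction on `α` can replace `h` by
`partialDeriv j h`. -/
theorem multiDeriv_add_single' (hD : IsOpen D) {h : (Fin n → ℂ) → ℂ}
    (hh : DifferentiableOn ℂ h D) (α : Fin n →₀ ℕ) (j : Fin n) :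
    EqOn (multiDeriv (α + Finsupp.single j 1) h) (multiDeriv α (partialDeriv j h)) D :=
  (multiDeriv_add_single hD hh α j).trans (foldr_partialDeriv hD hh α j _).symm

theorem multiDeriv_zero (h : (Fin n → ℂ) → ℂ) : multiDeriv 0 h = h := by
  unfold multiDeriv
  simp

@[elab_as_elim]
theorem exponent_induction {P : (Fin n →₀ ℕ) → Prop} (α : Fin n →₀ ℕ) (zero : P 0)
    (add_single : ∀ α j, P α → P (α + Finsupp.single j 1)) : P α := by
  suffices ∀ β, P β → P (β + α) by simpa using this 0 zero
  induction α using Finsupp.induction_linear with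
  | zero => simp
  | add f g hf hg => exact fun β hβ => by simpa [add_assoc] using hg _ (hf β hβ)
  | single i k =>
    induction k with
    | zero => simp
    | succ k ih =>
      intro β hβ
      rw [Finsupp.single_add, ← add_assoc]
      exact add_single _ _ (ih β hβ)

theorem partialDeriv_sum (hD : IsOpen D) {ι : Type*} (s : Finset ι) (c : ι → ℂ)
    {g : ι → (Fin n → ℂ) → ℂ} (hg : ∀ i ∈ s, DifferentiableOn ℂ (g i) D) (j : Fin n) :
    EqOn (partialDeriv j fun z => ∑ i ∈ s, c i * g i z)
      (fun z => ∑ i ∈ s, c i * partialDeriv j (g i) z) D := by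
  intro z hz
  have hd : ∀ i ∈ s, DifferentiableAt ℂ (g i) z := fun i hi =>
    (hg i hi).differentiableAt (hD.mem_nhds hz)
  simp only [partialDeriv]
  rw [fderiv_fun_sum fun i hi => (hd i hi).const_mul (c i)]
  simp only [sum_apply]
  refine Finset.sum_congr rfl fun i hi => ?_
  rw [fderiv_const_mul (hd i hi)]
  simp

theorem multiDeriv_sum (hD : IsOpen D) {ι : Type*} (s : Finset ι) (c : ι → ℂ)
    {g : ι → (Fin n → ℂ) → ℂ} (hg : ∀ i ∈ s, DifferentiableOn ℂ (g i) D) (α : Fin n →₀ ℕ) :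
    EqOn (multiDeriv α fun z => ∑ i ∈ s, c i * g i z)
      (fun z => ∑ i ∈ s, c i * multiDeriv α (g i) z) D := by
  induction α using exponent_induction with
  | zero => simp only [multiDeriv_zero]; exact fun _ _ => rfl
  | add_single α j ih =>
    have hd : DifferentiableOn ℂ (fun z => ∑ i ∈ s, c i * g i z) D :=
      DifferentiableOn.fun_sum fun i hi => (hg i hi).const_mul (c i)
    refine (multiDeriv_add_single hD hd α j).trans ((partialDeriv_congr hD ih j).trans
      ((partialDeriv_sum hD s c
        (fun i hi => differentiableOn_multiDeriv hD (hg i hi) α) j).trans fun z hz => ?_))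
    exact Finset.sum_congr rfl fun i hi => by
      simp only [multiDeriv_add_single hD (hg i hi) α j hz]

theorem multiDeriv_sub (hD : IsOpen D) {g h : (Fin n → ℂ) → ℂ} (hg : DifferentiableOn ℂ g D)
    (hh : DifferentiableOn ℂ h D) (α : Fin n →₀ ℕ) :
    EqOn (multiDeriv α fun z => g z - h z) (fun z => multiDeriv α g z - multiDeriv α h z) D := by
  have := multiDeriv_sum hD (Finset.univ : Finset (Fin 2)) ![1, -1] (g := ![g, h])
    (by simp [Fin.forall_fin_two, hg, hh]) α
  simpa [Fin.sum_univ_two, ← sub_eq_add_neg] using this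

theorem differentiable_eval (p : MvPolynomial (Fin n) ℂ) :
    Differentiable ℂ fun z : Fin n → ℂ => MvPolynomial.eval z p := by
  induction p using MvPolynomial.induction_on with
  | C a => simp
  | add p q hp hq => simpa using hp.fun_add hq
  | mul_X p i hp => simpa using hp.fun_mul (differentiable_apply i)

theorem partialDeriv_eval (p : MvPolynomial (Fin n) ℂ) (i : Fin n) :
    partialDeriv i (fun z => MvPolynomial.eval z p) =
      fun z => MvPolynomial.eval z (MvPolynomial.pderiv i p) := by
  ext z
  unfold partialDeriv
  induction p using MvPolynomial.induction_on with
  | C a => simp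
  | add p q hp hq =>
    simp only [map_add]
    rw [fderiv_fun_add (differentiable_eval p z) (differentiable_eval q z)]
    simp [hp, hq]
  | mul_X p j hp =>
    simp only [map_mul, MvPolynomial.eval_X]
    rw [fderiv_fun_mul (differentiable_eval p z) (differentiableAt_apply j z),
      show fderiv ℂ (fun x : Fin n → ℂ => x j) z = ContinuousLinearMap.proj j from
        (ContinuousLinearMap.proj (R := ℂ) (φ := fun _ : Fin n => ℂ) j).fderiv]
    simp [hp, MvPolynomial.pderiv_X, Pi.single_apply, mul_comm, eq_comm, apply_ite]

/-- The constant is $\alpha!$; only its independence of `p` and its nonvanishing are used. -/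
theorem multiDeriv_eval_zero (α : Fin n →₀ ℕ) :
    ∃ c : ℂ, c ≠ 0 ∧ ∀ p : MvPolynomial (Fin n) ℂ,
      multiDeriv α (fun z => MvPolynomial.eval z p) 0 = c * p.coeff α := by
  induction α using exponent_induction with
  | zero => exact ⟨1, one_ne_zero, fun p => by
      simp [multiDeriv_zero, MvPolynomial.constantCoeff_eq]⟩
  | add_single α j ih =>
    obtain ⟨c, hc, hp⟩ := ih
    refine ⟨c * (α j + 1), mul_ne_zero hc (Nat.cast_add_one_ne_zero _), fun p => ?_⟩
    rw [multiDeriv_add_single' isOpen_univ (differentiable_eval p).differentiableOn α j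
      (mem_univ _), partialDeriv_eval, hp, MvPolynomial.coeff_pderiv]
    ring

end MultiDeriv

/-! ### Identity theorem and order of vanishing at the origin -/

section Identity
variable {n : ℕ} {D : Set (Fin n → ℂ)}

/-- Restricting to the complex line through `w` and `v` reduces this to the one-variable identity
theorem, on a convex slice of the ball. -/
theorem eq_zero_of_eventuallyEq_zero_of_mem_ball {c w v : Fin n → ℂ} {r : ℝ}
    {h : (Fin n → ℂ) → ℂ} (hh : DifferentiableOn ℂ h (ball c r)) (hw : w ∈ ball c r)
    (hv : v ∈ ball c r) (hzero : h =ᶠ[𝓝 w] 0) : h v = 0 := by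
  let ℓ : ℂ → (Fin n → ℂ) := fun t => w + t • (v - w)
  have hℓ : Differentiable ℂ ℓ := by fun_prop
  have hopen : IsOpen (ℓ ⁻¹' ball c r) := isOpen_ball.preimage hℓ.continuous
  have hconv : Convex ℝ (ℓ ⁻¹' ball c r) := by
    intro s hs t ht a b ha hb hab
    have := convex_ball c r hs ht ha hb hab
    rw [mem_preimage]
    convert this using 1
    ext i
    have hab' : (a : ℂ) + b = 1 := by exact_mod_cast hab
    simp only [ℓ, Pi.add_apply, Pi.smul_apply, smul_eq_mul, Complex.real_smul, Pi.sub_apply]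
    linear_combination (-(w i)) * hab'
  have han : AnalyticOnNhd ℂ (h ∘ ℓ) (ℓ ⁻¹' ball c r) :=
    (hh.comp hℓ.differentiableOn (mapsTo_preimage _ _)).analyticOnNhd hopen
  have h0 : (0 : ℂ) ∈ ℓ ⁻¹' ball c r := by simpa [ℓ] using hw
  have h1 : (1 : ℂ) ∈ ℓ ⁻¹' ball c r := by simpa [ℓ] using hv
  have hev : h ∘ ℓ =ᶠ[𝓝 0] 0 := by
    have : Tendsto ℓ (𝓝 0) (𝓝 w) := by
      have := hℓ.continuous.tendsto 0
      simpa [ℓ] using this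
    exact this.eventually hzero
  simpa [ℓ] using han.eqOn_zero_of_preconnected_of_eventuallyEq_zero hconv.isPreconnected h0 hev h1

/-- The set of points near which `h` vanishes is open, and by the ball case relatively closed in
`D`. -/
theorem eqOn_zero_of_eventuallyEq_zero (hD : IsOpen D) (hc : IsPreconnected D)
    {h : (Fin n → ℂ) → ℂ} (hh : DifferentiableOn ℂ h D) {w : Fin n → ℂ} (hw : w ∈ D)
    (hzero : h =ᶠ[𝓝 w] 0) : EqOn h 0 D := by
  have hopen : IsOpen {z | h =ᶠ[𝓝 z] 0} := isOpen_setOfPred_eventually_nhds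
  have hsub : D ⊆ {z | h =ᶠ[𝓝 z] 0} := by
    refine hc.subset_of_closure_inter_subset hopen ⟨w, hw, hzero⟩ ?_
    rintro z ⟨hz, hzD⟩
    obtain ⟨r, hr, hrD⟩ := Metric.isOpen_iff.1 hD z hzD
    obtain ⟨y, hy, hyr⟩ := Metric.mem_closure_iff.1 hz r hr
    filter_upwards [ball_mem_nhds z hr] with v hv
    exact eq_zero_of_eventuallyEq_zero_of_mem_ball (hh.mono hrD) (mem_ball'.2 hyr) hv hy
  exact fun z hz => (hsub hz).self_of_nhds

/-- The directional derivative in the direction `v`. -/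
noncomputable def dirDeriv (v : Fin n → ℂ) (h : (Fin n → ℂ) → ℂ) : (Fin n → ℂ) → ℂ :=
  fun z => ∑ i, v i * partialDeriv i h z

theorem differentiableOn_iterate_dirDeriv (hD : IsOpen D) {h : (Fin n → ℂ) → ℂ}
    (hh : DifferentiableOn ℂ h D) (v : Fin n → ℂ) (k : ℕ) :
    DifferentiableOn ℂ ((dirDeriv v)^[k] h) D := by
  induction k with
  | zero => exact hh
  | succ k ih =>
    rw [Function.iterate_succ_apply']
    exact DifferentiableOn.fun_sum fun i _ => (differentiableOn_partialDeriv hD ih i).const_mul _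

theorem multiDeriv_iterate_dirDeriv_zero (hD : IsOpen D) (h0 : (0 : Fin n → ℂ) ∈ D)
    {h : (Fin n → ℂ) → ℂ} (hh : DifferentiableOn ℂ h D) (hflat : ∀ α, multiDeriv α h 0 = 0)
    (v : Fin n → ℂ) (k : ℕ) : ∀ α, multiDeriv α ((dirDeriv v)^[k] h) 0 = 0 := by
  induction k with
  | zero => exact hflat
  | succ k ih =>
    intro α
    rw [Function.iterate_succ_apply']
    have hk := differentiableOn_iterate_dirDeriv hD hh v k
    refine (multiDeriv_sum hD Finset.univ v
      (fun i _ => differentiableOn_partialDeriv hD hk i) α h0).trans ?_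
    refine Finset.sum_eq_zero fun i _ => ?_
    rw [← multiDeriv_add_single' hD hk α i h0, ih, mul_zero]

theorem iteratedDeriv_comp_line (hD : IsOpen D) {h : (Fin n → ℂ) → ℂ}
    (hh : DifferentiableOn ℂ h D) (v : Fin n → ℂ) (k : ℕ) {t : ℂ} (ht : t • v ∈ D) :
    iteratedDeriv k (fun s : ℂ => h (s • v)) t = (dirDeriv v)^[k] h (t • v) := by
  induction k generalizing t with
  | zero => simp
  | succ k ih =>
    rw [iteratedDeriv_succ, Function.iterate_succ_apply']
    have hcont : Continuous fun s : ℂ => s • v := by fun_prop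
    have hev : iteratedDeriv k (fun s : ℂ => h (s • v)) =ᶠ[𝓝 t]
        fun s => (dirDeriv v)^[k] h (s • v) := by
      filter_upwards [(hD.preimage hcont).mem_nhds ht] with s hs using ih hs
    rw [hev.deriv_eq]
    have hd := ((differentiableOn_iterate_dirDeriv hD hh v k).differentiableAt
      (hD.mem_nhds ht)).hasFDerivAt
    have h2 : HasDerivAt (fun s : ℂ => s • v) v t := by
      simpa using (hasDerivAt_id t).smul_const v
    have h3 := (hd.comp_hasDerivAt t h2).deriv
    rw [fderiv_apply_eq_sum] at h3
    exact h3

/-- A holomorphic function on a domain all of whose derivatives vanish at the origin is zero. -/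
theorem eqOn_zero_of_multiDeriv_eq_zero (hD : IsOpen D) (hc : IsPreconnected D)
    (h0 : (0 : Fin n → ℂ) ∈ D) {h : (Fin n → ℂ) → ℂ} (hh : DifferentiableOn ℂ h D)
    (hflat : ∀ α, multiDeriv α h 0 = 0) : EqOn h 0 D := by
  obtain ⟨r, hr, hrD⟩ := Metric.isOpen_iff.1 hD 0 h0
  refine eqOn_zero_of_eventuallyEq_zero hD hc hh h0 ?_
  filter_upwards [ball_mem_nhds 0 (half_pos hr)] with v hv
  -- Since `v` lies in the ball of half the radius, the slice is holomorphic on a disc containing `t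
  -- = 1`, where its Taylor series gives `h v`.
  have hmem : ∀ t ∈ ball (0 : ℂ) 2, t • v ∈ D := by
    intro t ht
    apply hrD
    rw [mem_ball_zero_iff] at *
    rw [norm_smul]
    nlinarith [norm_nonneg v, norm_nonneg t]
  have hg : DifferentiableOn ℂ (fun s : ℂ => h (s • v)) (ball 0 2) :=
    hh.comp (by fun_prop) hmem
  have hT := Complex.taylorSeries_eq_on_ball (c := 0) (r := 2) (z := 1) hg (by simp)
  have hz : ∀ k, iteratedDeriv k (fun s : ℂ => h (s • v)) 0 = 0 := by
    intro k
    rw [iteratedDeriv_comp_line hD hh v k (by simpa using h0), zero_smul]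
    simpa [multiDeriv_zero] using multiDeriv_iterate_dirDeriv_zero hD h0 hh hflat v k 0
  simpa [hz] using hT.symm

/-- A holomorphic function on a domain with finitely many nonzero Taylor coefficients at the origin
is a polynomial. -/
theorem exists_eqOn_eval (hD : IsOpen D) (hc : IsPreconnected D) (h0 : (0 : Fin n → ℂ) ∈ D)
    {h : (Fin n → ℂ) → ℂ} (hh : DifferentiableOn ℂ h D) (s : Finset (Fin n →₀ ℕ))
    (hs : ∀ α ∉ s, multiDeriv α h 0 = 0) :
    ∃ p : MvPolynomial (Fin n) ℂ, p.support ⊆ s ∧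
      EqOn h (fun z => MvPolynomial.eval z p) D := by
  choose c hc0 hcp using multiDeriv_eval_zero (n := n)
  let p : MvPolynomial (Fin n) ℂ :=
    ∑ α ∈ s, MvPolynomial.monomial α (multiDeriv α h 0 / c α)
  have hp : ∀ α, p.coeff α = multiDeriv α h 0 / c α := by
    intro α
    simp only [p, MvPolynomial.coeff_sum, MvPolynomial.coeff_monomial, Finset.sum_ite_eq']
    split_ifs with h
    · rfl
    · rw [hs α h, zero_div]
  refine ⟨p, fun α hα => ?_, fun z hz => ?_⟩
  · by_contra hαs
    rw [MvPolynomial.mem_support_iff, hp, hs α hαs, zero_div] at hα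
    exact hα rfl
  · have hpd := (differentiable_eval p).differentiableOn (s := D)
    refine sub_eq_zero.1 (eqOn_zero_of_multiDeriv_eq_zero hD hc h0 (hh.sub hpd) (fun α => ?_) hz)
    refine (multiDeriv_sub hD hh hpd α h0).trans ?_
    simp only [hcp, hp, mul_div_cancel₀ _ (hc0 α), sub_self]

theorem eq_of_eqOn_eval (hD : IsOpen D) (h0 : (0 : Fin n → ℂ) ∈ D) {p q : MvPolynomial (Fin n) ℂ}
    (hpq : EqOn (fun z => MvPolynomial.eval z p) (fun z => MvPolynomial.eval z q) D) : p = q := by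
  ext α
  obtain ⟨c, hc, hcp⟩ := multiDeriv_eval_zero α
  have := multiDeriv_congr hD hpq α h0
  rw [hcp, hcp] at this
  exact mul_left_cancel₀ hc this

/-- Cauchy's estimate on the ball of centre `z` and radius `‖z‖`, all of whose points have norm
below `2 * ‖z‖`, costs exactly one power of `‖z‖`. -/
theorem partialDeriv_isBigO (hD : IsOpen D) (h0 : (0 : Fin n → ℂ) ∈ D) {h : (Fin n → ℂ) → ℂ}
    (hh : DifferentiableOn ℂ h D) {N : ℕ} (hO : h =O[𝓝 0] fun z => ‖z‖ ^ (N + 1)) (i : Fin n) :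
    partialDeriv i h =O[𝓝 0] fun z => ‖z‖ ^ N := by
  rcases Nat.eq_zero_or_pos N with rfl | hN
  · simp only [pow_zero]
    exact ((differentiableOn_partialDeriv hD hh i).differentiableAt
      (hD.mem_nhds h0)).continuousAt.isBigO_one ℝ
  obtain ⟨C, hC⟩ := hO.bound
  obtain ⟨r, hr, hball⟩ := Metric.mem_nhds_iff.1 (inter_mem hC (hD.mem_nhds h0))
  -- At `z = 0` the ball of radius `‖z‖` is empty, so this point is treated apart; here `N + 1 > 1`.
  have hfd0 : fderiv ℂ h 0 = 0 := by
    have hO' : h =O[𝓝 0] fun z => ‖z - 0‖ ^ (N + 1) := by simpa using hO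
    exact (hO'.hasFDerivAt (𝕜 := ℂ) (by omega)).fderiv
  refine Asymptotics.IsBigO.of_bound (2 * |C| * 2 ^ (N + 1)) ?_
  filter_upwards [ball_mem_nhds 0 (half_pos hr)] with z hz
  rw [mem_ball_zero_iff] at hz
  rcases eq_or_ne z 0 with rfl | hz0
  · simp only [partialDeriv, hfd0, zero_apply, norm_zero]
    positivity
  have hzpos : 0 < ‖z‖ := norm_pos_iff.2 hz0
  have hlt : ∀ y ∈ ball z ‖z‖, ‖y‖ < 2 * ‖z‖ := by
    intro y hy
    rw [mem_ball, dist_eq_norm] at hy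
    have := norm_add_le (y - z) z
    rw [sub_add_cancel] at this
    linarith
  have hmem : ∀ y ∈ ball z ‖z‖, y ∈ ball (0 : Fin n → ℂ) r := fun y hy => by
    rw [mem_ball_zero_iff]
    linarith [hlt y hy]
  have hbd : ∀ y ∈ ball z ‖z‖, ‖h y‖ ≤ |C| * (2 * ‖z‖) ^ (N + 1) := by
    intro y hy
    have h1 : ‖h y‖ ≤ C * ‖‖y‖ ^ (N + 1)‖ := (hball (hmem y hy)).1
    rw [norm_pow, norm_norm] at h1
    refine h1.trans ?_
    gcongr
    · exact le_abs_self C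
    · exact (hlt y hy).le
  have hF := Complex.norm_fderiv_le_div_of_mapsTo_ball (f := h) (c := z) (R₁ := ‖z‖)
    (R₂ := 2 * (|C| * (2 * ‖z‖) ^ (N + 1)))
    (hh.mono fun y hy => (hball (hmem y hy)).2) (fun y hy => by
      rw [mem_closedBall, dist_eq_norm]
      have h1 := hbd y hy
      have h2 := hbd z (mem_ball_self hzpos)
      exact (norm_sub_le _ _).trans (by linarith)) hzpos
  calc ‖partialDeriv i h z‖ ≤ ‖fderiv ℂ h z‖ * ‖(Pi.single i 1 : Fin n → ℂ)‖ :=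
        (fderiv ℂ h z).le_opNorm _
    _ = ‖fderiv ℂ h z‖ := by rw [Pi.norm_single]; simp
    _ ≤ 2 * (|C| * (2 * ‖z‖) ^ (N + 1)) / ‖z‖ := hF
    _ = 2 * |C| * 2 ^ (N + 1) * ‖‖z‖ ^ N‖ := by
      rw [norm_pow, norm_norm]
      field_simp
      ring

/-- Order of vanishing is expressed by growth because that form passes easily through composition
with `F` and multiplication by its Jacobian. -/
theorem multiDeriv_eq_zero_of_isBigO (hD : IsOpen D) (h0 : (0 : Fin n → ℂ) ∈ D)
    (α : Fin n →₀ ℕ) : ∀ {h : (Fin n → ℂ) → ℂ}, DifferentiableOn ℂ h D → ∀ {N : ℕ},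
    (h =O[𝓝 0] fun z => ‖z‖ ^ N) → α.degree < N → multiDeriv α h 0 = 0 := by
  induction α using exponent_induction with
  | zero =>
    intro h _ N hO hN
    rw [multiDeriv_zero]
    have hO' : h =O[𝓝 0] fun z => ‖z - 0‖ ^ N := by simpa using hO
    exact hO'.eq_zero_of_norm_pow (by omega)
  | add_single α j ih =>
    intro h hh N hO hN
    rw [map_add, Finsupp.degree_single] at hN
    obtain ⟨N, rfl⟩ : ∃ M, N = M + 1 := ⟨N - 1, by omega⟩
    rw [multiDeriv_add_single' hD hh α j h0]
    exact ih (differentiableOn_partialDeriv hD hh j) (partialDeriv_isBigO hD h0 hh hO j)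
      (by omega)

end Identity

/-! ### The circle action and its weight components -/

section Rotation
variable {n : ℕ} {D : Set (Fin n → ℂ)} (m : Fin n → ℕ)

/-- The weighted rotation `z ↦ (e^{i m₁ θ} z₁, …, e^{i mₙ θ} zₙ)`. -/
noncomputable def rotation (θ : ℝ) : (Fin n → ℂ) →L[ℂ] (Fin n → ℂ) :=
  ∑ i, Complex.exp (Complex.I * (m i : ℂ) * (θ : ℂ)) •
    (ContinuousLinearMap.single ℂ (fun _ : Fin n => ℂ) i).comp (ContinuousLinearMap.proj i)

theorem rotation_apply (θ : ℝ) (z : Fin n → ℂ) :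
    rotation m θ z = fun i => Complex.exp (Complex.I * (m i : ℂ) * (θ : ℂ)) * z i := by
  ext i
  simp [rotation, Finset.sum_apply, Pi.single_apply]

theorem continuous_rotation : Continuous (rotation m) := by
  unfold rotation
  fun_prop

theorem rotation_single (θ : ℝ) (i : Fin n) :
    rotation m θ (Pi.single i 1) =
      Complex.exp (Complex.I * (m i : ℂ) * (θ : ℂ)) • Pi.single i 1 := by
  ext j
  rw [rotation_apply]
  by_cases hij : j = i
  · subst hij; simp
  · simp [hij]

theorem rotation_neg_rotation (θ : ℝ) (z : Fin n → ℂ) :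
    rotation m (-θ) (rotation m θ z) = z := by
  ext i
  simp only [rotation_apply]
  rw [← mul_assoc, ← Complex.exp_add]
  simp

theorem measurePreserving_rotation (θ : ℝ) :
    MeasurePreserving (rotation m θ) volume volume := by
  have h1 : ∀ i, MeasurePreserving
      (fun w : ℂ => Complex.exp (Complex.I * (m i : ℂ) * (θ : ℂ)) * w) volume volume := by
    intro i
    have e : (fun w : ℂ => Complex.exp (Complex.I * (m i : ℂ) * (θ : ℂ)) * w) =
        _root_.rotation (Circle.exp (m i * θ)) := by
      ext w
      rw [_root_.rotation_apply, Circle.coe_exp]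
      congr 2
      push_cast
      ring
    rw [e]
    exact (_root_.rotation (Circle.exp (m i * θ))).measurePreserving
  have e : ⇑(rotation m θ) =
      fun z i => Complex.exp (Complex.I * (m i : ℂ) * (θ : ℂ)) * z i := by
    ext1 z
    exact rotation_apply m θ z
  rw [e]
  exact volume_preserving_pi h1

theorem measurableEmbedding_rotation (θ : ℝ) : MeasurableEmbedding (rotation m θ) :=
  (rotation m θ).continuous.measurableEmbedding
    (Function.LeftInverse.injective (rotation_neg_rotation m θ))

theorem eval_rotation {k : ℕ} {q : MvPolynomial (Fin n) ℂ}
    (hq : MvPolynomial.IsWeightedHomogeneous m q k) (θ : ℝ) (z : Fin n → ℂ) :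
    MvPolynomial.eval (rotation m θ z) q =
      Complex.exp (Complex.I * (k : ℂ) * (θ : ℂ)) * MvPolynomial.eval z q := by
  rw [MvPolynomial.eval_eq', MvPolynomial.eval_eq', Finset.mul_sum]
  refine Finset.sum_congr rfl fun α hα => ?_
  have hk := hq (MvPolynomial.mem_support_iff.1 hα)
  simp only [rotation_apply, mul_pow, Finset.prod_mul_distrib]
  have : ∏ i, Complex.exp (Complex.I * (m i : ℂ) * (θ : ℂ)) ^ α i =
      Complex.exp (Complex.I * (k : ℂ) * (θ : ℂ)) := by
    simp_rw [← Complex.exp_nat_mul]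
    rw [← Complex.exp_sum, ← hk, Finsupp.weight_apply, Finsupp.sum_fintype _ _ (by simp)]
    congr 1
    push_cast [smul_eq_mul]
    rw [Finset.mul_sum, Finset.sum_mul]
    exact Finset.sum_congr rfl fun i _ => by ring
  rw [this]
  ring

variable {m}

theorem IsBoundedQuasiCircularDomain.rotation_mem (hD : IsBoundedQuasiCircularDomain m D) (θ : ℝ)
    {z : Fin n → ℂ} (hz : z ∈ D) : rotation m θ z ∈ D := by
  rw [rotation_apply]
  exact hD.invariant θ z hz

theorem IsBoundedQuasiCircularDomain.preimage_rotation (hD : IsBoundedQuasiCircularDomain m D)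
    (θ : ℝ) : rotation m θ ⁻¹' D = D := by
  refine Subset.antisymm (fun z hz => ?_) fun z hz => hD.rotation_mem θ hz
  rw [← rotation_neg_rotation m θ z]
  exact hD.rotation_mem _ hz

theorem IsBoundedQuasiCircularDomain.measurePreserving_restrict
    (hD : IsBoundedQuasiCircularDomain m D) (θ : ℝ) :
    MeasurePreserving (rotation m θ) (volume.restrict D) (volume.restrict D) := by
  have := (measurePreserving_rotation m θ).restrict_preimage hD.isOpen.measurableSet
  rwa [hD.preimage_rotation] at this

/-- The component of weight `k` of `h` under the circle action. -/
noncomputable def circleAvg (m : Fin n → ℕ) (k : ℤ) (h : (Fin n → ℂ) → ℂ) : (Fin n → ℂ) → ℂ :=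
  fun z => (2 * Real.pi : ℂ)⁻¹ * ∫ θ in (0 : ℝ)..2 * Real.pi,
    Complex.exp (-Complex.I * (k : ℂ) * (θ : ℂ)) * h (rotation m θ z)

theorem circleAvg_congr (hD : IsBoundedQuasiCircularDomain m D) {g h : (Fin n → ℂ) → ℂ}
    (hgh : EqOn g h D) (k : ℤ) : EqOn (circleAvg m k g) (circleAvg m k h) D := by
  intro z hz
  simp only [circleAvg, hgh (hD.rotation_mem _ hz)]

theorem hasFDerivAt_circleAvg (hD : IsBoundedQuasiCircularDomain m D) {h : (Fin n → ℂ) → ℂ}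
    (hh : DifferentiableOn ℂ h D) (k : ℤ) {z : Fin n → ℂ} (hz : z ∈ D) :
    HasFDerivAt (circleAvg m k h) ((2 * Real.pi : ℂ)⁻¹ • ∫ θ in (0 : ℝ)..2 * Real.pi,
      Complex.exp (-Complex.I * (k : ℂ) * (θ : ℂ)) •
        (fderiv ℂ h (rotation m θ z)).comp (rotation m θ)) z := by
  have := hasFDerivAt_integral_comp_affine hD.isOpen hh (a := 0) (b := 2 * Real.pi)
    (fun θ => Complex.exp (-Complex.I * (k : ℂ) * (θ : ℂ))) (by fun_prop) (rotation m)
    (continuous_rotation m) (fun _ => 0) continuous_const z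
    (fun θ _ => by simpa using hD.rotation_mem θ hz)
  simp only [add_zero] at this
  exact this.const_mul _

theorem differentiableOn_circleAvg (hD : IsBoundedQuasiCircularDomain m D)
    {h : (Fin n → ℂ) → ℂ} (hh : DifferentiableOn ℂ h D) (k : ℤ) :
    DifferentiableOn ℂ (circleAvg m k h) D := fun _ hz =>
  (hasFDerivAt_circleAvg hD hh k hz).differentiableAt.differentiableWithinAt

/-- By the chain rule, $\partial_i$ brings out the factor $e^{im_i\theta}$ from the rotation, which
lowers the weight by $m_i$. -/
theorem partialDeriv_circleAvg (hD : IsBoundedQuasiCircularDomain m D)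
    {h : (Fin n → ℂ) → ℂ} (hh : DifferentiableOn ℂ h D) (k : ℤ) (i : Fin n) :
    EqOn (partialDeriv i (circleAvg m k h)) (circleAvg m (k - m i) (partialDeriv i h)) D := by
  intro z hz
  rw [partialDeriv, (hasFDerivAt_circleAvg hD hh k hz).fderiv, circleAvg, smul_apply, smul_eq_mul]
  have hrot := continuous_rotation m
  have hint : IntervalIntegrable (fun θ : ℝ => Complex.exp (-Complex.I * (k : ℂ) * (θ : ℂ)) •
      (fderiv ℂ h (rotation m θ z)).comp (rotation m θ)) volume 0 (2 * Real.pi) := by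
    refine Continuous.intervalIntegrable ?_ _ _
    have h1 : Continuous fun θ => fderiv ℂ h (rotation m θ z) :=
      (differentiableOn_fderiv hD.isOpen hh).continuousOn.comp_continuous (by fun_prop)
        fun θ => hD.rotation_mem θ hz
    exact Continuous.smul (f := fun θ : ℝ => Complex.exp (-Complex.I * (k : ℂ) * (θ : ℂ)))
      (by fun_prop) (h1.clm_comp hrot)
  rw [ContinuousLinearMap.intervalIntegral_apply hint]
  congr 1
  refine intervalIntegral.integral_congr fun θ _ => ?_
  simp only [smul_apply, ContinuousLinearMap.comp_apply, rotation_single, map_smul, smul_eq_mul,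
    partialDeriv]
  rw [← mul_assoc, ← Complex.exp_add]
  congr 2
  push_cast
  ring

theorem multiDeriv_circleAvg (hD : IsBoundedQuasiCircularDomain m D) {h : (Fin n → ℂ) → ℂ}
    (hh : DifferentiableOn ℂ h D) (k : ℤ) (α : Fin n →₀ ℕ) :
    EqOn (multiDeriv α (circleAvg m k h))
      (circleAvg m (k - (Finsupp.weight m α : ℕ)) (multiDeriv α h)) D := by
  induction α using exponent_induction with
  | zero => simp only [multiDeriv_zero, map_zero, Nat.cast_zero, sub_zero]; exact fun _ _ => rfl
  | add_single α j ih =>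
    have hα := differentiableOn_multiDeriv hD.isOpen hh α
    refine (multiDeriv_add_single hD.isOpen (differentiableOn_circleAvg hD hh k) α j).trans
      ((partialDeriv_congr hD.isOpen ih j).trans ((partialDeriv_circleAvg hD hα _ j).trans ?_))
    have hw : (k - (Finsupp.weight m (α + Finsupp.single j 1) : ℕ) : ℤ) =
        k - (Finsupp.weight m α : ℕ) - m j := by
      rw [map_add, Finsupp.weight_single, one_smul]
      push_cast
      ring
    rw [hw]
    exact circleAvg_congr hD (multiDeriv_add_single hD.isOpen hh α j).symm _

theorem circleAvg_apply_zero (k : ℤ) (h : (Fin n → ℂ) → ℂ) :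
    circleAvg m k h 0 = if k = 0 then h 0 else 0 := by
  simp only [circleAvg, map_zero, intervalIntegral.integral_mul_const]
  split_ifs with hk
  · simp [hk, ← mul_assoc, Real.pi_ne_zero]
  · have hc : -Complex.I * (k : ℂ) ≠ 0 :=
      mul_ne_zero (neg_ne_zero.2 Complex.I_ne_zero) (Int.cast_ne_zero.2 hk)
    have h2 : Complex.exp (-Complex.I * (k : ℂ) * ((2 * Real.pi : ℝ) : ℂ)) = 1 := by
      rw [Complex.exp_eq_one_iff]
      exact ⟨-k, by push_cast; ring⟩
    rw [integral_exp_mul_complex hc, h2]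
    simp

/-- Differentiating the average shifts its weight to $k-m\cdot\alpha$, and at the fixed point `0` an
average of nonzero weight vanishes. So only the finitely many derivatives of weight `k` survive. -/
theorem exists_circleAvg_eqOn_eval (hD : IsBoundedQuasiCircularDomain m D)
    {h : (Fin n → ℂ) → ℂ} (hh : DifferentiableOn ℂ h D) (k : ℕ) :
    ∃ p : MvPolynomial (Fin n) ℂ, MvPolynomial.IsWeightedHomogeneous m p k ∧
      EqOn (circleAvg m k h) (fun z => MvPolynomial.eval z p) D ∧
      ∀ α, Finsupp.weight m α = k →
        multiDeriv α (fun z => MvPolynomial.eval z p) 0 = multiDeriv α h 0 := by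
  have hfin : {α : Fin n →₀ ℕ | Finsupp.weight m α = k}.Finite :=
    Finsupp.finite_of_nat_weight_eq m (fun x => (hD.weight_pos x).ne') k
  have hval : ∀ α, multiDeriv α (circleAvg m k h) 0 =
      if Finsupp.weight m α = k then multiDeriv α h 0 else 0 := by
    intro α
    rw [multiDeriv_circleAvg hD hh k α hD.zero_mem, circleAvg_apply_zero]
    simp only [sub_eq_zero, Nat.cast_inj, @eq_comm ℕ k]
  obtain ⟨p, hps, hp⟩ := exists_eqOn_eval hD.isOpen hD.isConnected.isPreconnected hD.zero_mem
    (differentiableOn_circleAvg hD hh k) hfin.toFinset (fun α hα => by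
      rw [hval, if_neg (by simpa using hα)])
  refine ⟨p, fun α hα => ?_, hp, fun α hα => ?_⟩
  · simpa using hps (MvPolynomial.mem_support_iff.2 hα)
  · rw [← multiDeriv_congr hD.isOpen hp α hD.zero_mem, hval, if_pos hα]

end Rotation

/-! ### Orthogonality of weight components -/

section Projection
variable {n : ℕ} {D : Set (Fin n → ℂ)} {m : Fin n → ℕ}

theorem IsBoundedQuasiCircularDomain.isFiniteMeasure (hD : IsBoundedQuasiCircularDomain m D) :
    IsFiniteMeasure (volume.restrict D) :=
  ⟨by simpa using hD.isBounded.measure_lt_top⟩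

theorem IsBoundedQuasiCircularDomain.exists_bound (hD : IsBoundedQuasiCircularDomain m D)
    {g : (Fin n → ℂ) → ℂ} (hg : Continuous g) : ∃ C, ∀ z ∈ D, ‖g z‖ ≤ C := by
  obtain ⟨C, hC⟩ := hD.isBounded.isCompact_closure.exists_bound_of_continuousOn hg.continuousOn
  exact ⟨C, fun z hz => hC z (subset_closure hz)⟩

theorem IsBoundedQuasiCircularDomain.memLp_eval (hD : IsBoundedQuasiCircularDomain m D)
    (p : MvPolynomial (Fin n) ℂ) :
    MemLp (fun z => MvPolynomial.eval z p) 2 (volume.restrict D) := by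
  have := hD.isFiniteMeasure
  have hc := (differentiable_eval p).continuous
  obtain ⟨C, hC⟩ := hD.exists_bound hc
  exact MemLp.of_bound hc.aestronglyMeasurable C
    ((ae_restrict_iff' hD.isOpen.measurableSet).2 (Eventually.of_forall hC))

theorem integrable_mul_conj {μ : Measure (Fin n → ℂ)} {φ ψ : (Fin n → ℂ) → ℂ}
    (hφ : MemLp φ 2 μ) (hψ : MemLp ψ 2 μ) :
    Integrable (fun z => φ z * (starRingEnd ℂ) (ψ z)) μ :=
  hφ.integrable_mul (p := 2) (q := 2) hψ.star

/-- Pairing with a weighted homogeneous polynomial of weight `k` only sees the component of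
weight `k`. -/
theorem innerL2_circleAvg (hD : IsBoundedQuasiCircularDomain m D) {h : (Fin n → ℂ) → ℂ}
    (hh : DifferentiableOn ℂ h D) (hL : MemLp h 2 (volume.restrict D)) {k : ℕ}
    {q : MvPolynomial (Fin n) ℂ} (hq : MvPolynomial.IsWeightedHomogeneous m q k) :
    innerL2 D (circleAvg m k h) (fun z => MvPolynomial.eval z q) =
      innerL2 D h (fun z => MvPolynomial.eval z q) := by
  set F : (Fin n → ℂ) → ℂ := fun z => h z * (starRingEnd ℂ) (MvPolynomial.eval z q) with hF
  have hFint : Integrable F (volume.restrict D) := integrable_mul_conj hL (hD.memLp_eval q)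
  have hFc : ContinuousOn F D :=
    hh.continuousOn.mul (Complex.continuous_conj.comp (differentiable_eval q).continuous).continuousOn
  have hrot : Continuous fun x : ℝ × (Fin n → ℂ) => rotation m x.1 x.2 :=
    ((continuous_rotation m).comp continuous_fst).clm_apply continuous_snd
  have hconj : ∀ (θ : ℝ) (z : Fin n → ℂ), F (rotation m θ z) =
      Complex.exp (-Complex.I * (k : ℂ) * (θ : ℂ)) * h (rotation m θ z) *
        (starRingEnd ℂ) (MvPolynomial.eval z q) := by
    intro θ z
    rw [hF]
    simp only [eval_rotation m hq, map_mul, ← Complex.exp_conj, Complex.conj_I,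
      Complex.conj_ofReal, Complex.conj_natCast]
    ring
  -- Fubini applies because the $L^1$ norm of $F\circ\rho_\theta$ over `D` does not depend on `θ`.
  have hprod : Integrable (Function.uncurry fun (θ : ℝ) z => F (rotation m θ z))
      ((volume.restrict (uIoc 0 (2 * Real.pi))).prod (volume.restrict D)) := by
    rw [integrable_prod_iff]
    · refine ⟨Eventually.of_forall fun θ => ?_, ?_⟩
      · exact (hD.measurePreserving_restrict θ).integrable_comp_of_integrable hFint
      · have : ∀ θ : ℝ, ∫ z in D, ‖F (rotation m θ z)‖ = ∫ z in D, ‖F z‖ := fun θ =>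
          (hD.measurePreserving_restrict θ).integral_comp (measurableEmbedding_rotation m θ)
            (fun z => ‖F z‖)
        simp only [Function.uncurry_apply_pair, this]
        exact (intervalIntegrable_const (μ := volume)).def'
    · rw [Measure.prod_restrict]
      refine ContinuousOn.aestronglyMeasurable ?_ (measurableSet_uIoc.prod hD.isOpen.measurableSet)
      exact hFc.comp hrot.continuousOn fun x hx => hD.rotation_mem _ hx.2
  have hswap := intervalIntegral_integral_swap hprod
  have hleft : ∀ θ : ℝ, ∫ z in D, F (rotation m θ z) = ∫ z in D, F z := fun θ =>
    (hD.measurePreserving_restrict θ).integral_comp (measurableEmbedding_rotation m θ) F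
  simp only [hleft, intervalIntegral.integral_const, sub_zero] at hswap
  have hpi : (2 * Real.pi : ℂ) ≠ 0 := by simp [Real.pi_ne_zero]
  have hright : ∀ z, (circleAvg m k h z) * (starRingEnd ℂ) (MvPolynomial.eval z q) =
      (2 * Real.pi : ℂ)⁻¹ * ∫ θ in (0 : ℝ)..2 * Real.pi, F (rotation m θ z) := by
    intro z
    simp only [hconj, intervalIntegral.integral_mul_const, circleAvg, Int.cast_natCast]
    ring
  unfold innerL2
  simp only [hright]
  rw [integral_const_mul, ← hswap, Complex.real_smul]
  push_cast
  rw [inv_mul_cancel_left₀ hpi]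

theorem innerL2_congr (hD : IsOpen D) {φ ψ χ : (Fin n → ℂ) → ℂ} (h : EqOn φ ψ D) :
    innerL2 D φ χ = innerL2 D ψ χ :=
  setIntegral_congr_fun hD.measurableSet fun z hz => by simp only [h hz]

/-- The weight `k` part of the Taylor expansion of `h`, as a polynomial. -/
theorem exists_weight_component (hD : IsBoundedQuasiCircularDomain m D)
    {h : (Fin n → ℂ) → ℂ} (hh : DifferentiableOn ℂ h D) (hL : MemLp h 2 (volume.restrict D))
    (k : ℕ) :
    ∃ p : MvPolynomial (Fin n) ℂ, MvPolynomial.IsWeightedHomogeneous m p k ∧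
      (∀ α, Finsupp.weight m α = k →
        multiDeriv α (fun z => MvPolynomial.eval z p) 0 = multiDeriv α h 0) ∧
      ∀ q, MvPolynomial.IsWeightedHomogeneous m q k →
        innerL2 D h (fun z => MvPolynomial.eval z q) =
          innerL2 D (fun z => MvPolynomial.eval z p) (fun z => MvPolynomial.eval z q) := by
  obtain ⟨p, hp, hpD, hpα⟩ := exists_circleAvg_eqOn_eval hD hh k
  exact ⟨p, hp, hpα, fun q hq => by
    rw [← innerL2_circleAvg hD hh hL hq, innerL2_congr hD.isOpen hpD]⟩

end Projection

/-! ### Reproducing polynomials and finiteness of the sets $Q_k$ -/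

section Reproducing
variable {n : ℕ} {D : Set (Fin n → ℂ)} {m : Fin n → ℕ}

theorem innerL2_conj_symm (φ ψ : (Fin n → ℂ) → ℂ) :
    (starRingEnd ℂ) (innerL2 D φ ψ) = innerL2 D ψ φ := by
  unfold innerL2
  rw [← integral_conj]
  simp [mul_comm]

theorem eq_zero_of_innerL2_self (hD : IsBoundedQuasiCircularDomain m D)
    {p : MvPolynomial (Fin n) ℂ}
    (hp : innerL2 D (fun z => MvPolynomial.eval z p) (fun z => MvPolynomial.eval z p) = 0) :
    p = 0 := by
  have hint := integrable_mul_conj (hD.memLp_eval p) (hD.memLp_eval p)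
  have hc := (differentiable_eval p).continuous
  unfold innerL2 at hp
  simp only [Complex.mul_conj] at hp hint
  replace hp := integral_complex_ofReal.symm.trans hp
  have hint' : Integrable (fun z => Complex.normSq (MvPolynomial.eval z p)) (volume.restrict D) := by
    simpa using hint.re
  have h0 := (integral_eq_zero_iff_of_nonneg (fun z => Complex.normSq_nonneg _) hint').1
    (by exact_mod_cast hp)
  -- Continuity upgrades vanishing almost everywhere to vanishing on the open set `D`.
  have hE := Measure.eqOn_open_of_ae_eq h0 hD.isOpen
    (Complex.continuous_normSq.comp hc).continuousOn continuousOn_const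
  refine eq_of_eqOn_eval hD.isOpen hD.zero_mem fun z hz => ?_
  simpa using hE hz

theorem integrable_eval_mul_eval_conj (hD : IsBoundedQuasiCircularDomain m D)
    (p q : MvPolynomial (Fin n) ℂ) :
    Integrable (fun z => MvPolynomial.eval z q *
      (starRingEnd ℂ) (MvPolynomial.eval z (MvPolynomial.map (starRingEnd ℂ) p)))
      (volume.restrict D) :=
  integrable_mul_conj (hD.memLp_eval q) (hD.memLp_eval _)

/-- The pairing `(p, q) ↦ ⟨q, p*⟩_D` where `p*` has the conjugate coefficients, which is bilinear. -/
noncomputable def conjPairing (hD : IsBoundedQuasiCircularDomain m D) (k : ℕ) :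
    MvPolynomial.weightedHomogeneousSubmodule ℂ m k →ₗ[ℂ]
      Module.Dual ℂ (MvPolynomial.weightedHomogeneousSubmodule ℂ m k) :=
  LinearMap.mk₂ ℂ
    (fun p q => innerL2 D (fun z => MvPolynomial.eval z q.1)
      (fun z => MvPolynomial.eval z (MvPolynomial.map (starRingEnd ℂ) p.1)))
    (fun p p' q => by
      unfold innerL2
      rw [← integral_add (integrable_eval_mul_eval_conj hD _ _)
        (integrable_eval_mul_eval_conj hD _ _)]
      simp [mul_add])
    (fun c p q => by
      unfold innerL2
      rw [smul_eq_mul, ← integral_const_mul]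
      simp [MvPolynomial.smul_eq_C_mul, mul_left_comm])
    (fun p q q' => by
      unfold innerL2
      rw [← integral_add (integrable_eval_mul_eval_conj hD _ _)
        (integrable_eval_mul_eval_conj hD _ _)]
      simp [add_mul])
    (fun c p q => by
      unfold innerL2
      rw [smul_eq_mul, ← integral_const_mul]
      simp [MvPolynomial.smul_eq_C_mul, mul_assoc])

theorem isWeightedHomogeneous_map {k : ℕ} {p : MvPolynomial (Fin n) ℂ}
    (hp : MvPolynomial.IsWeightedHomogeneous m p k) :
    MvPolynomial.IsWeightedHomogeneous m (MvPolynomial.map (starRingEnd ℂ) p) k := by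
  intro α hα
  refine hp fun h0 => hα ?_
  rw [MvPolynomial.coeff_map, h0, map_zero]

/-- Riesz representation in finite dimension: a `p` in the kernel pairs to zero with its own
conjugate $p^*$, so $\|p^*\|^2=0$, and injectivity gives surjectivity. -/
theorem conjPairing_surjective (hD : IsBoundedQuasiCircularDomain m D) (k : ℕ) :
    Function.Surjective (conjPairing hD k) := by
  have : Module.Finite ℂ (MvPolynomial.weightedHomogeneousSubmodule ℂ m k) :=
    Module.Finite.iff_fg.2 (MvPolynomial.weightedHomogeneousSubmodule_fg ℂ m
      (fun x => (hD.weight_pos x).ne') k)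
  refine (LinearMap.injective_iff_surjective_of_finrank_eq_finrank
    Subspace.dual_finrank_eq.symm).1 ?_
  rw [← LinearMap.ker_eq_bot, LinearMap.ker_eq_bot']
  intro p hp
  have h1 := LinearMap.congr_fun hp ⟨_, isWeightedHomogeneous_map p.2⟩
  have h2 := eq_zero_of_innerL2_self hD h1
  refine Subtype.ext (MvPolynomial.map_injective _ (starRingEnd ℂ).injective ?_)
  exact h2.trans (map_zero _).symm

theorem exists_isReproducing (hD : IsBoundedQuasiCircularDomain m D) (α : Fin n →₀ ℕ) :
    ∃ p, IsReproducing D α p ∧ MvPolynomial.IsWeightedHomogeneous m p (Finsupp.weight m α) := by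
  obtain ⟨c, -, hc⟩ := multiDeriv_eval_zero α
  -- The functional is $r\mapsto\partial^\alpha r(0)$, written as `c` times the coefficient at `α`.
  obtain ⟨p, hp⟩ := conjPairing_surjective hD (Finsupp.weight m α)
    ((c • MvPolynomial.lcoeff ℂ α).comp (Submodule.subtype _))
  have hhom := isWeightedHomogeneous_map p.2
  refine ⟨_, fun h hh hL => ?_, hhom⟩
  obtain ⟨r, hr, hrα, hrq⟩ := exists_weight_component hD hh hL (Finsupp.weight m α)
  rw [hrq _ hhom, ← hrα α rfl, hc]
  exact LinearMap.congr_fun hp ⟨r, hr⟩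

theorem IsReproducing.unique (hD : IsBoundedQuasiCircularDomain m D) {α : Fin n →₀ ℕ}
    {p q : MvPolynomial (Fin n) ℂ} (hp : IsReproducing D α p) (hq : IsReproducing D α q) :
    p = q := by
  refine sub_eq_zero.1 (eq_zero_of_innerL2_self hD ?_)
  have hd := (differentiable_eval (p - q)).differentiableOn (s := D)
  have h := (hp _ hd (hD.memLp_eval _)).trans (hq _ hd (hD.memLp_eval _)).symm
  rw [← sub_eq_zero, innerL2, innerL2,
    ← integral_sub (integrable_mul_conj (hD.memLp_eval _) (hD.memLp_eval _))
      (integrable_mul_conj (hD.memLp_eval _) (hD.memLp_eval _))] at h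
  rw [← h, innerL2]
  simp [mul_sub]

theorem isReproducing_reproPoly (hD : IsBoundedQuasiCircularDomain m D) (α : Fin n →₀ ℕ) :
    IsReproducing D α (reproPoly D α) := by
  have h : ∃ p, IsReproducing D α p := (exists_isReproducing hD α).imp fun _ hp => hp.1
  rw [reproPoly, dif_pos h]
  exact h.choose_spec

theorem isWeightedHomogeneous_reproPoly (hD : IsBoundedQuasiCircularDomain m D)
    (α : Fin n →₀ ℕ) :
    MvPolynomial.IsWeightedHomogeneous m (reproPoly D α) (Finsupp.weight m α) := by
  obtain ⟨p, hp, hhom⟩ := exists_isReproducing hD α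
  rwa [(isReproducing_reproPoly hD α).unique hD hp]

/-- Testing against $z^\alpha$ gives $\alpha!\neq0$. Consequently the infimum defining `minDegree`
runs over a nonempty set and is attained, not the default `0`. -/
theorem reproPoly_ne_zero (hD : IsBoundedQuasiCircularDomain m D) (α : Fin n →₀ ℕ) :
    reproPoly D α ≠ 0 := by
  intro h0
  obtain ⟨c, hc, hcp⟩ := multiDeriv_eval_zero α
  have := isReproducing_reproPoly hD α _
    (differentiable_eval (MvPolynomial.monomial α 1)).differentiableOn (hD.memLp_eval _)
  rw [hcp, h0] at this
  simp [innerL2, hc.symm] at this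

theorem lt_degree_of_notMem_quasiSet {k : ℕ} {α β : Fin n →₀ ℕ} (hα : α ∉ quasiSet D k)
    (hβ : (reproPoly D α).coeff β ≠ 0) : k < β.degree := by
  simp only [quasiSet, mem_compl_iff, mem_ofPred_eq, not_not] at hα
  exact hα.trans_le (Nat.sInf_le ⟨β, hβ, rfl⟩)

theorem exists_of_mem_quasiSet (hD : IsBoundedQuasiCircularDomain m D) {k : ℕ}
    {α : Fin n →₀ ℕ} (hα : α ∈ quasiSet D k) :
    ∃ β : Fin n →₀ ℕ, β.degree ≤ k ∧ Finsupp.weight m β = Finsupp.weight m α := by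
  obtain ⟨γ, hγ⟩ := MvPolynomial.ne_zero_iff.1 (reproPoly_ne_zero hD α)
  obtain ⟨β, hβ, hdeg⟩ := Nat.sInf_mem (s := Finsupp.degree '' {β | (reproPoly D α).coeff β ≠ 0})
    ⟨_, γ, hγ, rfl⟩
  simp only [quasiSet, mem_compl_iff, mem_ofPred_eq, not_lt] at hα
  exact ⟨β, hdeg.trans_le hα, isWeightedHomogeneous_reproPoly hD α hβ⟩

/-- Some monomial $z^\beta$ of $p_\alpha$ has $|\beta|\le k$, so $m\cdot\alpha=m\cdot\beta\le
k\max_j m_j$, and positive weights leave finitely many such `α`. -/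
theorem finite_quasiSet (hD : IsBoundedQuasiCircularDomain m D) (k : ℕ) :
    (quasiSet D k).Finite := by
  refine ((finite_le_nat (k * Finset.univ.sup m)).biUnion fun j _ =>
    Finsupp.finite_of_nat_weight_eq m (fun x => (hD.weight_pos x).ne') j).subset fun α hα => ?_
  obtain ⟨β, hβ, hw⟩ := exists_of_mem_quasiSet hD hα
  simp only [mem_iUnion, mem_ofPred_eq]
  refine ⟨_, ?_, rfl⟩
  rw [← hw, Finsupp.weight_apply, Finsupp.sum_fintype _ _ (by simp)]
  refine le_trans ?_ (Nat.mul_le_mul_right _ hβ)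
  rw [Finsupp.degree_eq_sum, Finset.sum_mul]
  exact Finset.sum_le_sum fun i _ => by
    simpa using Nat.mul_le_mul_left _ (Finset.le_sup (f := m) (Finset.mem_univ i))

theorem eq_zero_of_weight_eq_zero (hD : IsBoundedQuasiCircularDomain m D) {α : Fin n →₀ ℕ}
    (hα : Finsupp.weight m α = 0) : α = 0 := by
  rw [Finsupp.weight_apply, Finsupp.sum_fintype _ _ (by simp), Finset.sum_eq_zero_iff] at hα
  ext i
  simpa [(hD.weight_pos i).ne'] using hα i (Finset.mem_univ i)

theorem eq_zero_of_mem_quasiSet_zero (hD : IsBoundedQuasiCircularDomain m D) {α : Fin n →₀ ℕ}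
    (hα : α ∈ quasiSet D 0) : α = 0 := by
  obtain ⟨β, hβ, hw⟩ := exists_of_mem_quasiSet hD hα
  rw [Nat.le_zero, Finsupp.degree_eq_zero_iff] at hβ
  rw [hβ, map_zero] at hw
  exact eq_zero_of_weight_eq_zero hD hw.symm

theorem zero_mem_quasiSet (hD : IsBoundedQuasiCircularDomain m D) (k : ℕ) :
    (0 : Fin n →₀ ℕ) ∈ quasiSet D k := by
  by_contra h
  obtain ⟨γ, hγ⟩ := MvPolynomial.ne_zero_iff.1 (reproPoly_ne_zero hD 0)
  have h1 := lt_degree_of_notMem_quasiSet h hγ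
  have h2 := isWeightedHomogeneous_reproPoly hD 0 hγ
  rw [map_zero] at h2
  simp [eq_zero_of_weight_eq_zero hD h2] at h1

theorem isGreatest_quasiResonanceOrderAt (hD : IsBoundedQuasiCircularDomain m D) (i : Fin n) :
    IsGreatest (Finsupp.degree '' quasiSet D (resonanceOrder m i))
      (quasiResonanceOrderAt m D i) := by
  have hbdd := ((finite_quasiSet hD (resonanceOrder m i)).image Finsupp.degree).bddAbove
  exact ⟨Nat.sSup_mem ⟨_, 0, zero_mem_quasiSet hD _, rfl⟩ hbdd, fun _ hx => le_csSup hbdd hx⟩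

end Reproducing

/-! ### The action of automorphisms on the Bergman space and the degree bound -/

section Pullback
variable {n : ℕ} {D : Set (Fin n → ℂ)} {m : Fin n → ℕ}

/-- The complex Jacobian determinant. -/
noncomputable def jacobian (f : (Fin n → ℂ) → (Fin n → ℂ)) (z : Fin n → ℂ) : ℂ :=
  LinearMap.det (fderiv ℂ f z : (Fin n → ℂ) →ₗ[ℂ] (Fin n → ℂ))

/-- The action of a holomorphic map on the Bergman space, `φ ↦ (φ ∘ f) · J_f`. -/
noncomputable def pullback (f : (Fin n → ℂ) → (Fin n → ℂ)) (φ : (Fin n → ℂ) → ℂ) :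
    (Fin n → ℂ) → ℂ :=
  fun z => φ (f z) * jacobian f z

/-- The Leibniz formula makes the determinant a polynomial in the partial derivatives of the
components. -/
theorem differentiableOn_jacobian (hD : IsOpen D) {f : (Fin n → ℂ) → (Fin n → ℂ)}
    (hf : DifferentiableOn ℂ f D) : DifferentiableOn ℂ (jacobian f) D := by
  have hfi : ∀ i, DifferentiableOn ℂ (fun z => f z i) D := differentiableOn_pi.1 hf
  have heq : EqOn (jacobian f) (fun z => ∑ σ : Equiv.Perm (Fin n), (Equiv.Perm.sign σ : ℂ) *
      ∏ i, partialDeriv i (fun w => f w (σ i)) z) D := by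
    intro z hz
    rw [jacobian, ← LinearMap.det_toMatrix', Matrix.det_apply']
    refine Finset.sum_congr rfl fun σ _ => ?_
    congr 1
    refine Finset.prod_congr rfl fun i _ => ?_
    have hd := (hf.differentiableAt (hD.mem_nhds hz)).hasFDerivAt
    rw [partialDeriv, (hasFDerivAt_pi'.1 hd (σ i)).fderiv, LinearMap.toMatrix'_apply]
    simp
  refine DifferentiableOn.congr ?_ heq
  refine DifferentiableOn.fun_sum fun σ _ => DifferentiableOn.const_mul ?_ _
  exact fun z hz => (HasFDerivWithinAt.finsetProd fun i _ =>
    (differentiableOn_partialDeriv hD (hfi (σ i)) i z hz).hasFDerivWithinAt).differentiableWithinAt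

theorem jacobian_mul_jacobian (hD : IsOpen D) {f F : (Fin n → ℂ) → (Fin n → ℂ)}
    (hf : DifferentiableOn ℂ f D) (hF : DifferentiableOn ℂ F D) (hfD : MapsTo f D D)
    (hFf : ∀ z ∈ D, F (f z) = z) {z : Fin n → ℂ} (hz : z ∈ D) :
    jacobian F (f z) * jacobian f z = 1 := by
  have h1 := (hf.differentiableAt (hD.mem_nhds hz)).hasFDerivAt
  have h2 := (hF.differentiableAt (hD.mem_nhds (hfD hz))).hasFDerivAt
  have h3 := h2.comp z h1
  have h4 : F ∘ f =ᶠ[𝓝 z] id := by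
    filter_upwards [hD.mem_nhds hz] with w hw using hFf w hw
  have h5 := h3.unique ((hasFDerivAt_id z).congr_of_eventuallyEq h4)
  rw [jacobian, jacobian, ← LinearMap.det_comp]
  exact (congrArg (fun A : (Fin n → ℂ) →L[ℂ] (Fin n → ℂ) =>
    LinearMap.det (A : (Fin n → ℂ) →ₗ[ℂ] (Fin n → ℂ))) h5).trans LinearMap.det_id

theorem abs_det_restrictScalars (A : (Fin n → ℂ) →L[ℂ] (Fin n → ℂ)) :
    |(A.restrictScalars ℝ).det| = Complex.normSq (LinearMap.det (A : (Fin n → ℂ) →ₗ[ℂ] _)) := by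
  have : (A.restrictScalars ℝ).det =
      LinearMap.det ((A : (Fin n → ℂ) →ₗ[ℂ] (Fin n → ℂ)).restrictScalars ℝ) := rfl
  rw [this, LinearMap.det_restrictScalars, Algebra.norm_complex_eq]
  exact abs_of_nonneg (Complex.normSq_nonneg _)

section ChangeOfVariables
variable {f F : (Fin n → ℂ) → (Fin n → ℂ)}

theorem image_eq_of_inverse (hfD : MapsTo f D D) (hFD : MapsTo F D D)
    (hfF : ∀ z ∈ D, f (F z) = z) : f '' D = D :=
  Subset.antisymm hfD.image_subset fun z hz => ⟨F z, hFD hz, hfF z hz⟩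

theorem injOn_of_inverse (hFf : ∀ z ∈ D, F (f z) = z) : InjOn f D := fun z hz w hw h => by
  rw [← hFf z hz, h, hFf w hw]

theorem hasFDerivWithinAt_real (hD : IsOpen D) (hf : DifferentiableOn ℂ f D) :
    ∀ z ∈ D, HasFDerivWithinAt f ((fderiv ℂ f z).restrictScalars ℝ) D z := fun _ hz =>
  ((hf.differentiableAt (hD.mem_nhds hz)).hasFDerivAt.restrictScalars ℝ).hasFDerivWithinAt

theorem integral_eq_integral_comp (hD : IsOpen D) (hf : DifferentiableOn ℂ f D)
    (hfD : MapsTo f D D) (hFD : MapsTo F D D) (hFf : ∀ z ∈ D, F (f z) = z)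
    (hfF : ∀ z ∈ D, f (F z) = z) (g : (Fin n → ℂ) → ℂ) :
    ∫ z in D, g z = ∫ z in D, (Complex.normSq (jacobian f z) : ℂ) * g (f z) := by
  have := integral_image_eq_integral_abs_det_fderiv_smul volume hD.measurableSet
    (hasFDerivWithinAt_real hD hf) (injOn_of_inverse hFf) g
  rw [image_eq_of_inverse hfD hFD hfF] at this
  simpa only [abs_det_restrictScalars, Complex.real_smul, jacobian] using this

theorem differentiableOn_pullback (hD : IsOpen D) (hf : DifferentiableOn ℂ f D)
    (hfD : MapsTo f D D) {φ : (Fin n → ℂ) → ℂ} (hφ : DifferentiableOn ℂ φ D) :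
    DifferentiableOn ℂ (pullback f φ) D :=
  (hφ.comp hf hfD).mul (differentiableOn_jacobian hD hf)

theorem memLp_pullback (hD : IsOpen D) (hf : DifferentiableOn ℂ f D)
    (hfD : MapsTo f D D) (hFD : MapsTo F D D) (hFf : ∀ z ∈ D, F (f z) = z)
    (hfF : ∀ z ∈ D, f (F z) = z) {φ : (Fin n → ℂ) → ℂ} (hφ : DifferentiableOn ℂ φ D)
    (hL : MemLp φ 2 (volume.restrict D)) : MemLp (pullback f φ) 2 (volume.restrict D) := by
  rw [memLp_two_iff_integrable_sq_norm ((differentiableOn_pullback hD hf hfD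
    hφ).continuousOn.aestronglyMeasurable hD.measurableSet)]
  have h1 := (memLp_two_iff_integrable_sq_norm hL.1).1 hL
  have h2 := integrableOn_image_iff_integrableOn_abs_det_fderiv_smul volume hD.measurableSet
    (hasFDerivWithinAt_real hD hf) (injOn_of_inverse hFf) (fun z => ‖φ z‖ ^ 2)
  rw [image_eq_of_inverse hfD hFD hfF] at h2
  refine (h2.1 h1).congr (Eventually.of_forall fun z => ?_)
  simp only [abs_det_restrictScalars, pullback, smul_eq_mul, norm_mul, mul_pow, jacobian,
    Complex.normSq_eq_norm_sq]
  ring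

/-- Substituting $z\mapsto f(z)$ on the right produces $|J_f|^2$; its conjugate factor cancels
against $\overline{J_F\circ f}$ since $(J_F\circ f)J_f=1$. -/
theorem innerL2_pullback (hD : IsOpen D) (hf : DifferentiableOn ℂ f D)
    (hF : DifferentiableOn ℂ F D) (hfD : MapsTo f D D) (hFD : MapsTo F D D)
    (hFf : ∀ z ∈ D, F (f z) = z) (hfF : ∀ z ∈ D, f (F z) = z) (φ ψ : (Fin n → ℂ) → ℂ) :
    innerL2 D (pullback f φ) ψ = innerL2 D φ (pullback F ψ) := by
  unfold innerL2
  rw [integral_eq_integral_comp hD hf hfD hFD hFf hfF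
    fun z => φ z * (starRingEnd ℂ) (pullback F ψ z)]
  refine setIntegral_congr_fun hD.measurableSet fun z hz => ?_
  have hJ := congrArg (starRingEnd ℂ) (jacobian_mul_jacobian hD hf hF hfD hFf hz)
  simp only [map_mul, map_one] at hJ
  simp only [pullback, hFf z hz, map_mul, ← Complex.mul_conj]
  linear_combination (-φ (f z) * jacobian f z * (starRingEnd ℂ) (ψ z)) * hJ

end ChangeOfVariables

theorem isBigO_eval {p : MvPolynomial (Fin n) ℂ} {N : ℕ}
    (hp : ∀ β, p.coeff β ≠ 0 → N ≤ β.degree) :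
    (fun z => MvPolynomial.eval z p) =O[𝓝 0] fun z : Fin n → ℂ => ‖z‖ ^ N := by
  simp only [MvPolynomial.eval_eq']
  refine Asymptotics.IsBigO.fun_sum fun β hβ => Asymptotics.IsBigO.const_mul_left ?_ _
  refine Asymptotics.IsBigO.of_bound 1 ?_
  filter_upwards [ball_mem_nhds (0 : Fin n → ℂ) one_pos] with z hz
  rw [mem_ball_zero_iff] at hz
  rw [one_mul, norm_pow, norm_norm, norm_prod]
  calc ∏ i, ‖z i ^ β i‖ ≤ ∏ i, ‖z‖ ^ β i := by
        refine Finset.prod_le_prod (fun i _ => norm_nonneg _) fun i _ => ?_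
        rw [norm_pow]
        gcongr
        exact norm_le_pi_norm z i
    _ = ‖z‖ ^ β.degree := by rw [Finset.prod_pow_eq_pow_sum, Finsupp.degree_eq_sum]
    _ ≤ ‖z‖ ^ N := pow_le_pow_of_le_one (norm_nonneg z) hz.le
        (hp β (MvPolynomial.mem_support_iff.1 hβ))

theorem isBigO_pullback (hD : IsOpen D) (h0 : (0 : Fin n → ℂ) ∈ D)
    {F : (Fin n → ℂ) → (Fin n → ℂ)} (hF : DifferentiableOn ℂ F D) (hF0 : F 0 = 0)
    {φ : (Fin n → ℂ) → ℂ} {N : ℕ} (hφ : φ =O[𝓝 0] fun z => ‖z‖ ^ N) :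
    pullback F φ =O[𝓝 0] fun z => ‖z‖ ^ N := by
  have hFd := hF.differentiableAt (hD.mem_nhds h0)
  have hJ : jacobian F =O[𝓝 0] fun _ => (1 : ℝ) :=
    ((differentiableOn_jacobian hD hF).differentiableAt
      (hD.mem_nhds h0)).continuousAt.isBigO_one ℝ
  have hFt : Tendsto F (𝓝 0) (𝓝 0) := by
    have := hFd.continuousAt.tendsto
    rwa [hF0] at this
  have hFO : F =O[𝓝 0] fun z => z := by
    simpa [hF0] using hFd.hasFDerivAt.isBigO_sub
  have h1 : (fun z => φ (F z)) =O[𝓝 0] fun z => ‖F z‖ ^ N := hφ.comp_tendsto hFt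
  have h2 : (fun z => φ (F z)) =O[𝓝 0] fun z => ‖z‖ ^ N := h1.trans (hFO.norm_norm.pow N)
  unfold pullback
  simpa using h2.mul hJ

/-- The heart of the argument: the derivative is moved onto `q` as a pairing with $U_Fp_\alpha$,
which vanishes at `0` to too high an order to have a component of weight `k`. -/
theorem multiDeriv_pullback_eval_eq_zero (hD : IsBoundedQuasiCircularDomain m D)
    {f F : (Fin n → ℂ) → (Fin n → ℂ)} (hf : DifferentiableOn ℂ f D)
    (hF : DifferentiableOn ℂ F D) (hfD : MapsTo f D D) (hFD : MapsTo F D D)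
    (hFf : ∀ z ∈ D, F (f z) = z) (hfF : ∀ z ∈ D, f (F z) = z) (hF0 : F 0 = 0)
    {k N : ℕ} (hN : ∀ β : Fin n →₀ ℕ, Finsupp.weight m β = k → β.degree ≤ N)
    {q : MvPolynomial (Fin n) ℂ} (hq : MvPolynomial.IsWeightedHomogeneous m q k)
    {α : Fin n →₀ ℕ} (hα : α ∉ quasiSet D N) :
    multiDeriv α (pullback f fun z => MvPolynomial.eval z q) 0 = 0 := by
  have hqd := (differentiable_eval q).differentiableOn (s := D)
  have hpd := (differentiable_eval (reproPoly D α)).differentiableOn (s := D)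
  rw [← isReproducing_reproPoly hD α _ (differentiableOn_pullback hD.isOpen hf hfD hqd)
    (memLp_pullback hD.isOpen hf hfD hFD hFf hfF hqd (hD.memLp_eval q)),
    innerL2_pullback hD.isOpen hf hF hfD hFD hFf hfF, ← innerL2_conj_symm]
  have hhd := differentiableOn_pullback hD.isOpen hF hFD hpd
  obtain ⟨r, hr, hrβ, hrq⟩ := exists_weight_component hD hhd
    (memLp_pullback hD.isOpen hF hFD hfD hfF hFf hpd (hD.memLp_eval _)) k
  have hO := isBigO_pullback hD.isOpen hD.zero_mem hF hF0
    (isBigO_eval (p := reproPoly D α) (N := N + 1) fun β hβ => lt_degree_of_notMem_quasiSet hα hβ)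
  -- A monomial of `r` has weight `k`, hence degree at most `N`, while the pullback is
  -- $O(\|z\|^{N+1})$.
  have hr0 : r = 0 := by
    ext β
    rw [MvPolynomial.coeff_zero]
    by_contra hβ
    obtain ⟨c, hc, hcp⟩ := multiDeriv_eval_zero β
    have h1 := hrβ β (hr hβ)
    rw [multiDeriv_eq_zero_of_isBigO hD.isOpen hD.zero_mem β hhd hO
      (Nat.lt_succ_of_le (hN β (hr hβ))), hcp] at h1
    exact mul_ne_zero hc hβ h1
  rw [hrq q hq, hr0]
  simp [innerL2]

theorem exists_pullback_eqOn_eval (hD : IsBoundedQuasiCircularDomain m D)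
    {f F : (Fin n → ℂ) → (Fin n → ℂ)} (hf : DifferentiableOn ℂ f D)
    (hF : DifferentiableOn ℂ F D) (hfD : MapsTo f D D) (hFD : MapsTo F D D)
    (hFf : ∀ z ∈ D, F (f z) = z) (hfF : ∀ z ∈ D, f (F z) = z) (hF0 : F 0 = 0)
    {k N : ℕ} (hN : ∀ β : Fin n →₀ ℕ, Finsupp.weight m β = k → β.degree ≤ N)
    {q : MvPolynomial (Fin n) ℂ} (hq : MvPolynomial.IsWeightedHomogeneous m q k) :
    ∃ p : MvPolynomial (Fin n) ℂ, (∀ α ∈ p.support, α ∈ quasiSet D N) ∧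
      EqOn (pullback f fun z => MvPolynomial.eval z q) (fun z => MvPolynomial.eval z p) D := by
  obtain ⟨p, hp, hpD⟩ := exists_eqOn_eval hD.isOpen hD.isConnected.isPreconnected hD.zero_mem
    (differentiableOn_pullback hD.isOpen hf hfD (differentiable_eval q).differentiableOn)
    (finite_quasiSet hD N).toFinset (fun α hα =>
      multiDeriv_pullback_eval_eq_zero hD hf hF hfD hFD hFf hfF hF0 hN hq (by simpa using hα))
  exact ⟨p, fun α hα => by simpa using hp hα, hpD⟩

theorem exists_polynomial_of_isAutomorphism (hD : IsBoundedQuasiCircularDomain m D)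
    {f : (Fin n → ℂ) → (Fin n → ℂ)} (haut : IsAutomorphism D f) (hf0 : f 0 = 0) (i : Fin n) :
    ∃ p : MvPolynomial (Fin n) ℂ, (∀ z ∈ D, f z i = MvPolynomial.eval z p) ∧
      p.totalDegree ≤ quasiResonanceOrderAt m D i := by
  obtain ⟨hf, hfD, F, hF, hFD, hFf, hfF⟩ := haut
  have hF0 : F 0 = 0 := by
    have := hFf 0 hD.zero_mem
    rwa [hf0] at this
  -- The pullback of `1` is the Jacobian itself; as $Q_0=\{0\}$, it is constant.
  obtain ⟨a, ha, haD⟩ := exists_pullback_eqOn_eval hD hf hF hfD hFD hFf hfF hF0 (k := 0) (N := 0)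
    (fun β hβ => by simp [eq_zero_of_weight_eq_zero hD hβ])
    (MvPolynomial.isWeightedHomogeneous_one ℂ m)
  have hconst : a = MvPolynomial.C (a.coeff 0) := by
    ext α
    rw [MvPolynomial.coeff_C]
    split_ifs with h
    · rw [h]
    · by_contra hα
      exact h (eq_zero_of_mem_quasiSet_zero hD (ha α (MvPolynomial.mem_support_iff.2 hα))).symm
  have hJ : ∀ z ∈ D, jacobian f z = a.coeff 0 := by
    intro z hz
    have := haD hz
    rw [hconst] at this
    simpa [pullback] using this
  have hJ0 : a.coeff 0 ≠ 0 := by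
    rw [← hJ 0 hD.zero_mem]
    exact right_ne_zero_of_mul_eq_one
      (jacobian_mul_jacobian hD.isOpen hf hF hfD hFf hD.zero_mem)
  have hgr := isGreatest_resonanceOrder m hD.weight_pos i
  -- The pullback of $z_i$ is $f_iJ_f$, and dividing by the constant Jacobian leaves $f_i$.
  obtain ⟨p, hp, hpD⟩ := exists_pullback_eqOn_eval hD hf hF hfD hFD hFf hfF hF0
    (k := m i) (N := resonanceOrder m i) (fun β hβ => hgr.2 ⟨β, hβ, rfl⟩)
    (MvPolynomial.isWeightedHomogeneous_X ℂ m i)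
  refine ⟨MvPolynomial.C (a.coeff 0)⁻¹ * p, fun z hz => ?_, ?_⟩
  · have := hpD hz
    simp only [pullback, MvPolynomial.eval_X, hJ z hz] at this
    rw [map_mul, MvPolynomial.eval_C, ← this]
    field_simp
  · refine (MvPolynomial.totalDegree_mul _ _).trans ?_
    rw [MvPolynomial.totalDegree_C, zero_add]
    refine Finset.sup_le fun α hα => ?_
    exact (isGreatest_quasiResonanceOrderAt hD i).2 ⟨α, hp α hα, rfl⟩

end Pullback
end QuasiCircular

/-- The first two conjuncts say that the reproducing polynomials and the quasi-resonance orders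
are well defined; the third one is the degree bound for automorphisms fixing the origin. -/
theorem theorem1p1 (n : ℕ) (m : Fin n → ℕ) (D : Set (Fin n → ℂ))
    (hD : QuasiCircular.IsBoundedQuasiCircularDomain m D) :
    (∀ α : Fin n →₀ ℕ,
      (∃! p : MvPolynomial (Fin n) ℂ, QuasiCircular.IsReproducing D α p) ∧
      QuasiCircular.IsReproducing D α (QuasiCircular.reproPoly D α) ∧
      MvPolynomial.IsWeightedHomogeneous m (QuasiCircular.reproPoly D α)
        (Finsupp.weight m α)) ∧
    (∀ i : Fin n,
      IsGreatest
        (Finsupp.degree '' QuasiCircular.quasiSet D (QuasiCircular.resonanceOrder m i))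
        (QuasiCircular.quasiResonanceOrderAt m D i)) ∧
    ∀ f : (Fin n → ℂ) → (Fin n → ℂ), QuasiCircular.IsAutomorphism D f → f 0 = 0 →
      ∃ P : Fin n → MvPolynomial (Fin n) ℂ,
        (∀ z ∈ D, ∀ i, f z i = MvPolynomial.eval z (P i)) ∧
        (∀ i, (P i).totalDegree ≤ QuasiCircular.quasiResonanceOrderAt m D i) ∧
        Finset.univ.sup (fun i => (P i).totalDegree) ≤
          QuasiCircular.quasiResonanceOrder m D := by
  refine ⟨fun α => ?_, QuasiCircular.isGreatest_quasiResonanceOrderAt hD, fun f haut hf0 => ?_⟩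
  · have hr := QuasiCircular.isReproducing_reproPoly hD α
    exact ⟨⟨_, hr, fun p hp => hp.unique hD hr⟩, hr,
      QuasiCircular.isWeightedHomogeneous_reproPoly hD α⟩
  · choose P hP hdeg using QuasiCircular.exists_polynomial_of_isAutomorphism hD haut hf0
    exact ⟨P, fun z hz i => hP i z hz, hdeg, Finset.sup_mono_fun fun i _ => hdeg i⟩
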